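/- Let $\mathcal H$ be a finite-dimensional real Hilbert space, $S\subseteq\mathcal H$ nonempty, closed and convex, and consider the problem (P): minimize $f(x)/g(x)$ over $x\in S$, where $f,g:\mathcal H\to(-\infty,+\infty]$. Write $\operatorname{dom}f=\{x: f(x)<+\infty\}$, and let $\iota_A$ be the indicator function of a set $A$ ($0$ on $A$, $+\infty$ off $A$). For $h:\mathcal H\to[-\infty,+\infty]$ finite at $x$, let $$\widehat\partial h(x)=\Big\{u:\liminf_{z\to x,\,z\ne x}\tfrac{h(z)-h(x)-\langle u,z-x\rangle}{\|z-x\|}\ge 0\Big\}$$ be the Fréchet subdifferential and let the limiting subdifferential $\partial_Lh(x)$ consist of all limits of sequences $u_n\in\widehat\partial h(x_n)$ with $x_n\to x$, $h(x_n)\to h(x)$; both are empty where $h$ is not finite. $h$ is regular at $x$ if $\widehat\partial h(x)=\partial_Lh(x)$; a set is regular at $x$ if its indicator function is. $h$ is weakly convex on $A$ with constant $\beta\ge0$ if $h+\iota_A+\frac\beta2\|\cdot\|^2$ is convex. The function $f/g+\iota_S$ is $f/g$ on $S$ and $+\infty$ off $S$; a point $\overline x\in S$ is a stationary point of (P) if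 $0\in\partial_L(f/g+\iota_S)(\overline x)$. Assumptions. 1. $f=f^{\mathfrak s}+f^{\mathfrak n}$, where $f^{\mathfrak s}:\mathcal H\to\mathbb R$ is convex and $C^1$ with $\nabla f^{\mathfrak s}$ Lipschitz with constant $\ell\ge 0$, $f^{\mathfrak n}$ is proper and lower semicontinuous, $S\cap\operatorname{dom}f\neq\varnothing$, and $f\ge0$ on $S\cap\operatorname{dom}f$. 2. $g$ is proper and lower semicontinuous, finite and positive on $S$, continuous on an open set containing $S$, and either weakly convex with constant $\beta\ge 0$ on an open convex set containing $S$, or regular at every point of $S$ and weakly convex on $S$ with constant $\beta\ge 0$. 3. $f^{\mathfrak n}=f^{\mathfrak l}+\iota_C$ with $C$ nonempty and closed, $C\cap S\ne\varnothing$, and one of the following holds: (a) $f^{\mathfrak l}$ is locally Lipschitz on $\mathcal H$ and $C=S=\mathcal H$; (b) $f^{\mathfrak l}$ is locally Lipschitz on an open set containing $S\cap\operatorname{dom}f$, $f^{\mathfrak l}$ and $C\cap S$ are regular at every point of $S\cap\operatorname{dom}f$, and $g>0$ on an open set containing $S\cap\operatorname{dom}f$; (c) $f^{\mathfrak l}$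 is strictly differentiable on an open set containing $S\cap\operatorname{dom}f$, and $g>0$ on an open set containing $S\cap\operatorname{dom}f$. Algorithm (e-PSG). Condition (BC) with constants $m,M>0$ says: $m\le g(x)\le M$ for all $x\in S\cap\operatorname{dom}f$. Let $\delta,\zeta>0$ with $1-\sqrt\beta\zeta>0$. If (BC) holds for some $m,M>0$, fix such $m,M$, choose $$0\le\overline\mu<\frac{\delta(1-\sqrt\beta\zeta)\sqrt{mM}}{2M},\qquad 0\le\overline\kappa<\sqrt{\frac{m\delta(1-\sqrt\beta\zeta)}{\ell M}-\frac{2m\overline\mu}{\ell\sqrt{mM}}}$$ (the upper bound on $\overline\kappa$ is $+\infty$ if $\ell=0$), and put $c=\frac{\ell\overline\kappa^2}{2m}+\frac{\overline\mu}{2\sqrt{mM}}$. If (BC) holds for no $m,M$, put $\overline\mu=\overline\kappa=c=0$. Let $x_{-1}=x_0\in S\cap\operatorname{dom}f$ and, for every $n\ge 0$, let $\theta_n=f(x_n)/g(x_n)$, $g_n\in\partial_Lg(x_n)$, $0<\tau_n\le1/\max\{\sqrt\beta\theta_n/\zeta,\delta\}$, $u_n=x_n+\kappa_n(x_n-x_{n-1})$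 with $\kappa_n\in[0,\overline\kappa]$, $v_n=x_n+\mu_n(x_n-x_{n-1})$ with $\mu_n\in[0,\overline\mu\tau_n]$, and let $x_{n+1}$ be a minimizer over $x\in S$ of $$f^{\mathfrak n}(x)+f^{\mathfrak s}(u_n)+\langle\nabla f^{\mathfrak s}(u_n),x-u_n\rangle+\frac1{2\tau_n}\|x-v_n-\tau_n\theta_ng_n\|^2+\frac\ell2\|x-u_n\|^2.$$ KL property. For $\eta\in(0,+\infty]$ let $\Phi_\eta$ be the set of continuous concave $\varphi:[0,\eta)\to[0,+\infty)$ with $\varphi(0)=0$ that are $C^1$ on $(0,\eta)$ with $\varphi'>0$. A function $h$ has the KL property at $\overline z$, where $\partial_Lh(\overline z)\neq\varnothing$, if there are $\eta\in(0,+\infty]$, $\varphi\in\Phi_\eta$ and a neighborhood $U$ of $\overline z$ with $\varphi'(h(z)-h(\overline z))\operatorname{dist}(0,\partial_Lh(z))\ge1$ for all $z\in U$ with $h(\overline z)<h(z)<h(\overline z)+\eta$ (where $\operatorname{dist}(0,\varnothing)=+\infty$). It has the KL property with exponent $\alpha\in[0,1)$ if $\varphi(s)=\gamma s^{1-\alpha}$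 with some $\gamma>0$ can be taken. Theorem. Let $(x_n)_{n\ge0}$ be generated by the algorithm, with $\liminf_{n\to\infty}\tau_n>0$. Suppose that Assumptions 1, 2 and 3 hold, that $g$ is $C^1$ on an open set containing $S\cap\operatorname{dom}f$, that there are $\varepsilon,\ell_g>0$ with $\|\nabla g(x)-\nabla g(y)\|\le\ell_g\|x-y\|$ for all $x,y\in S\cap\operatorname{dom}f$ with $\|x-y\|\le\varepsilon$, that $\{x\in S: f(x)/g(x)\le f(x_0)/g(x_0)\}$ is bounded, and that $$h(x,y)=\frac{f(x)}{g(x)}+\iota_S(x)+c\|x-y\|^2\qquad\text{on }\mathcal H\times\mathcal H$$ has the KL property at $(\overline x,\overline x)$ for every $\overline x\in S\cap\operatorname{dom}f$. Then $\sum_{n=0}^\infty\|x_{n+1}-x_n\|<+\infty$, and $(x_n)$ converges to a stationary point $x_\infty$ of (P). Moreover, if for some $\alpha\le1/2$ the function $h$ has the KL property with exponent $\alpha$ at $(\overline x,\overline x)$ for every $\overline x\in S\cap\operatorname{dom}f$, then there are $\gamma_1,\gamma_2>0$ and $\rho\in(0,1)$ such that, for all $n\ge0$, $$|h(x_{n+1},x_n)-h(x_\infty,x_\infty)|\le\gamma_1\rho^n\quad\text{and}\quad\|x_n-x_\infty\|\le\gamma_2\rho^{n/2}.$$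 -/

import Mathlib

open Set Filter Topology

noncomputable section

namespace EPSG

/-! ### Extended real-valued functions and subdifferentials -/

section General

variable {E : Type*}

/-- The effective domain `{x | h x < +∞}`. -/
def dom (h : E → EReal) : Set E := {x | h x < ⊤}

/-- `h` takes a value `< +∞` somewhere and never takes the value `-∞`. -/
def IsProper (h : E → EReal) : Prop := (dom h).Nonempty ∧ ∀ x, h x ≠ ⊥

/-- `h` is finite at `x`. -/
def FiniteAt (h : E → EReal) (x : E) : Prop := h x ≠ ⊤ ∧ h x ≠ ⊥

/-- The function `h + ι_A`: equal to `h` on `A` and to `+∞` off `A`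
(whatever the value of `h` off `A`). -/
def restrict (A : Set E) (h : E → EReal) : E → EReal := by
  classical exact fun x => if x ∈ A then h x else ⊤

/-- The indicator function `ι_A` (`0` on `A`, `+∞` off `A`). -/
def indicatorFn (A : Set E) : E → EReal := restrict A (fun _ => 0)

variable [NormedAddCommGroup E] [InnerProductSpace ℝ E]

/-- Convexity of an extended real-valued function: its epigraph is convex. -/
def IsConvexFn (h : E → EReal) : Prop :=
  Convex ℝ {p : E × ℝ | h p.1 ≤ (p.2 : EReal)}

/-- `h` is weakly convex on `A` with constant `ρ`: `h + ι_A + (ρ/2)‖·‖²` is convex. -/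
def WeaklyConvexOn (A : Set E) (h : E → EReal) (ρ : ℝ) : Prop :=
  IsConvexFn (restrict A (fun x => h x + ((ρ / 2 * ‖x‖ ^ 2 : ℝ) : EReal)))

/-- The Fréchet subdifferential; empty where `h` is not finite. -/
def frechetSubdiff (h : E → EReal) (x : E) : Set E :=
  {u | FiniteAt h x ∧
    0 ≤ liminf (fun z => (h z - h x - ((inner ℝ u (z - x) : ℝ) : EReal)) / ((‖z - x‖ : ℝ) : EReal))
      (𝓝[≠] x)}

/-- The limiting subdifferential; empty where `h` is not finite. -/
def limitingSubdiff (h : E → EReal) (x : E) : Set E :=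
  {u | FiniteAt h x ∧ ∃ (y : ℕ → E) (v : ℕ → E),
    Tendsto y atTop (𝓝 x) ∧ Tendsto (fun n => h (y n)) atTop (𝓝 (h x)) ∧
    Tendsto v atTop (𝓝 u) ∧ ∀ n, v n ∈ frechetSubdiff h (y n)}

/-- `h` is (lower) regular at `x`. -/
def RegularAt (h : E → EReal) (x : E) : Prop := frechetSubdiff h x = limitingSubdiff h x

/-- The set `A` is regular at `x`: its Fréchet and limiting normal cones at `x` coincide. -/
def SetRegularAt (A : Set E) (x : E) : Prop := RegularAt (indicatorFn A) x

/-- `h` is finite and locally Lipschitz continuous on `U` (used for open `U`). -/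
def LocLipOn (U : Set E) (h : E → EReal) : Prop :=
  (∀ x ∈ U, FiniteAt h x) ∧ LocallyLipschitzOn U (fun x => (h x).toReal)

/-- `h` is finite and strictly differentiable at each point of `U` (used for open `U`). -/
def StrictDiffOn (U : Set E) (h : E → EReal) : Prop :=
  (∀ x ∈ U, FiniteAt h x) ∧
    ∀ x ∈ U, ∃ L : E →L[ℝ] ℝ, HasStrictFDerivAt (fun x => (h x).toReal) L x

/-- `h` is finite and continuously differentiable on `U` (used for open `U`). -/
def ContDiffFnOn (U : Set E) (h : E → EReal) : Prop :=
  (∀ x ∈ U, FiniteAt h x) ∧ ContDiffOn ℝ 1 (fun x => (h x).toReal) U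

/-! ### The Kurdyka–Łojasiewicz property -/

/-- The class `Φ_η` of desingularizing functions, for `η ∈ (0, +∞]`. -/
structure Desingularizing (η : EReal) (φ : ℝ → ℝ) : Prop where
  continuousOn : ContinuousOn φ {s : ℝ | 0 ≤ s ∧ (s : EReal) < η}
  concaveOn : ConcaveOn ℝ {s : ℝ | 0 ≤ s ∧ (s : EReal) < η} φ
  nonneg : ∀ s : ℝ, 0 ≤ s → (s : EReal) < η → 0 ≤ φ s
  map_zero : φ 0 = 0
  contDiffOn : ContDiffOn ℝ 1 φ {s : ℝ | 0 < s ∧ (s : EReal) < η}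
  deriv_pos : ∀ s : ℝ, 0 < s → (s : EReal) < η → 0 < deriv φ s

/-- `h` satisfies the KL inequality at `x̄ ∈ dom ∂_L h` with the function `φ ∈ Φ_η`,
on some neighbourhood of `x̄`. The distance to the empty set is `+∞`. -/
def KLWith (h : E → EReal) (xbar : E) (η : EReal) (φ : ℝ → ℝ) : Prop :=
  (limitingSubdiff h xbar).Nonempty ∧ 0 < η ∧ Desingularizing η φ ∧
    ∃ U ∈ 𝓝 xbar, ∀ x ∈ U, h xbar < h x → h x < h xbar + η →
      1 ≤ ENNReal.ofReal (deriv φ (h x - h xbar).toReal) *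
        Metric.infEDist (0 : E) (limitingSubdiff h x)

/-- The KL property at `x̄`. -/
def KLAt (h : E → EReal) (xbar : E) : Prop :=
  ∃ (η : EReal) (φ : ℝ → ℝ), KLWith h xbar η φ

/-- The KL property at `x̄` with exponent `α ∈ [0, 1)`: one may take `φ(s) = γ s^(1-α)`. -/
def KLExponentAt (h : E → EReal) (xbar : E) (α : ℝ) : Prop :=
  0 ≤ α ∧ α < 1 ∧ ∃ (η : EReal) (γ : ℝ), 0 < γ ∧
    KLWith h xbar η (fun s => γ * s ^ (1 - α))

end General

/-! ### The fractional program `min_{x ∈ S} f(x)/g(x)` -/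

section Program

variable {H : Type*} [NormedAddCommGroup H] [InnerProductSpace ℝ H]

/-- The function `f/g + ι_S`. -/
def ratioFn (S : Set H) (f g : H → EReal) : H → EReal := restrict S (fun x => f x / g x)

/-- `x̄` is a (limiting) stationary point of `min_{x ∈ S} f(x)/g(x)`. -/
def IsStationary (S : Set H) (f g : H → EReal) (xbar : H) : Prop :=
  xbar ∈ S ∧ (0 : H) ∈ limitingSubdiff (ratioFn S f g) xbar

/-- The merit function `h(x, y) = f(x)/g(x) + ι_S(x) + c‖x - y‖²` on the Hilbert space `H × H`. -/
def meritFn (S : Set H) (f g : H → EReal) (c : ℝ) : WithLp 2 (H × H) → EReal :=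
  fun z => ratioFn S f g z.fst + ((c * ‖z.fst - z.snd‖ ^ 2 : ℝ) : EReal)

/-- Assumption on the numerator `f = fs + fn`. -/
structure NumeratorAssumption [CompleteSpace H] (S : Set H) (f : H → EReal) (fs : H → ℝ)
    (fn : H → EReal) (ℓ : ℝ) : Prop where
  sum_eq : ∀ x, f x = (fs x : EReal) + fn x
  smooth : ContDiff ℝ 1 fs
  convex : ConvexOn ℝ univ fs
  modulus_nonneg : 0 ≤ ℓ
  lipschitz : ∀ x y, ‖gradient fs x - gradient fs y‖ ≤ ℓ * ‖x - y‖
  proper : IsProper fn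
  lsc : LowerSemicontinuous fn
  feasible : (S ∩ dom f).Nonempty
  nonneg : ∀ x ∈ S ∩ dom f, 0 ≤ f x

/-- Assumption on the denominator `g`. -/
structure DenominatorAssumption (S : Set H) (g : H → EReal) (β : ℝ) : Prop where
  proper : IsProper g
  lsc : LowerSemicontinuous g
  finite : ∀ x ∈ S, g x < ⊤
  pos : ∀ x ∈ S, 0 < g x
  continuous : ∃ U : Set H, IsOpen U ∧ S ⊆ U ∧ ContinuousOn g U
  modulus_nonneg : 0 ≤ β
  weaklyConvex :
    (∃ O : Set H, IsOpen O ∧ Convex ℝ O ∧ S ⊆ O ∧ WeaklyConvexOn O g β) ∨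
    ((∀ x ∈ S, RegularAt g x) ∧ WeaklyConvexOn S g β)

/-- Assumption on the nonsmooth part: `fn = fl + ι_C`, where one of three cases holds. -/
structure NonsmoothAssumption (S : Set H) (f fn g fl : H → EReal) (C : Set H) : Prop where
  nonempty : C.Nonempty
  closed : IsClosed C
  inter_nonempty : (C ∩ S).Nonempty
  eq : fn = restrict C fl
  cases :
    (LocLipOn univ fl ∧ C = univ ∧ S = univ) ∨
    ((∃ U : Set H, IsOpen U ∧ S ∩ dom f ⊆ U ∧ LocLipOn U fl) ∧
      (∀ x ∈ S ∩ dom f, RegularAt fl x ∧ SetRegularAt (C ∩ S) x) ∧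
      (∃ U : Set H, IsOpen U ∧ S ∩ dom f ⊆ U ∧ ∀ x ∈ U, 0 < g x)) ∨
    ((∃ U : Set H, IsOpen U ∧ S ∩ dom f ⊆ U ∧ StrictDiffOn U fl) ∧
      (∃ U : Set H, IsOpen U ∧ S ∩ dom f ⊆ U ∧ ∀ x ∈ U, 0 < g x))

/-- The boundedness condition: `0 < m ≤ g ≤ M` on `S ∩ dom f`. -/
def BoundCond (S : Set H) (f g : H → EReal) (m M : ℝ) : Prop :=
  0 < m ∧ 0 < M ∧ ∀ x ∈ S ∩ dom f, (m : EReal) ≤ g x ∧ g x ≤ (M : EReal)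

/-- Admissible parameters `δ, ζ, μ̄, κ̄` of the algorithm, together with the resulting constant `c`
of the merit function. If the boundedness condition fails, there is no extrapolation and `c = 0`.
For `ℓ = 0` the upper bound on `κ̄` is `+∞`. -/
structure AdmissibleParams (S : Set H) (f g : H → EReal) (ℓ β δ ζ μbar κbar c : ℝ) : Prop where
  δ_pos : 0 < δ
  ζ_pos : 0 < ζ
  ζ_lt : 0 < 1 - √β * ζ
  bounds :
    (∃ m M : ℝ, BoundCond S f g m M ∧
      (0 ≤ μbar ∧ μbar < δ * (1 - √β * ζ) * √(m * M) / (2 * M)) ∧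
      (0 ≤ κbar ∧ (0 < ℓ →
        κbar < √(m * δ * (1 - √β * ζ) / (ℓ * M) - 2 * m * μbar / (ℓ * √(m * M))))) ∧
      c = ℓ * κbar ^ 2 / (2 * m) + μbar / (2 * √(m * M))) ∨
    ((¬ ∃ m M : ℝ, BoundCond S f g m M) ∧ μbar = 0 ∧ κbar = 0 ∧ c = 0)

/-- The quotient `θ = f(x)/g(x)` as a real number. -/
def theta (f g : H → EReal) (x : H) : ℝ := (f x / g x).toReal

/-- The objective of the subproblem with data `τ, θ, w, u, v`. -/
def subproblem [CompleteSpace H] (fs : H → ℝ) (fn : H → EReal) (ℓ τ θ : ℝ) (w u v : H) :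
    H → EReal :=
  fun y => fn y + ((fs u + inner ℝ (gradient fs u) (y - u)
    + 1 / (2 * τ) * ‖y - v - (τ * θ) • w‖ ^ 2 + ℓ / 2 * ‖y - u‖ ^ 2 : ℝ) : EReal)

/-- `x` is a sequence of iterates of the extrapolated proximal subgradient algorithm, with step
sizes `τ`, extrapolation parameters `κ, μ` and subgradients `w`. Since `0 - 1 = 0` in `ℕ`,
`x (n - 1)` for `n = 0` is `x 0`, which is the convention `x₋₁ = x₀`. -/
structure IsIterates [CompleteSpace H] (S : Set H) (f : H → EReal) (fs : H → ℝ)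
    (fn g : H → EReal) (ℓ β δ ζ μbar κbar : ℝ) (x w : ℕ → H) (τ κ μ : ℕ → ℝ) : Prop where
  init : x 0 ∈ S ∩ dom f
  subgrad : ∀ n, w n ∈ limitingSubdiff g (x n)
  τ_pos : ∀ n, 0 < τ n
  τ_le : ∀ n, τ n ≤ 1 / max (√β * theta f g (x n) / ζ) δ
  κ_mem : ∀ n, κ n ∈ Icc 0 κbar
  μ_mem : ∀ n, μ n ∈ Icc 0 (μbar * τ n)
  mem : ∀ n, x (n + 1) ∈ S
  argmin : ∀ n, IsMinOn
    (subproblem fs fn ℓ (τ n) (theta f g (x n)) (w n)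
      (x n + κ n • (x n - x (n - 1))) (x n + μ n • (x n - x (n - 1)))) S (x (n + 1))

end Program

end EPSG

end

/-! Write `θ n = f (x n) / g (x n)` and `F n = θ n + c‖x n - x (n-1)‖²`. Three facts carry the
proof.

Sufficient decrease: `F (n+1) + α₀‖x (n+1) - x n‖² ≤ F n`. Compare the subproblem at its minimizer
`x (n+1)` and at `x n`, using the descent lemma and convexity for `fs` and the subgradient
inequality of the weakly convex `g`. This bounds `g (x (n+1)) (θ (n+1) - θ n)` (`mul_theta_sub_le`).
Dividing by `g` and splitting the extrapolation cross term by Young's inequality gives the decrease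
(`IsIterates.exists_sufficient_decrease`).

Relative error: minimality bounds `f` below on the feasible set by a differentiable function that
touches it at `x (n+1)`. Dividing by `g` gives a differentiable minorant of the ratio
(`exists_minorant_of_isMinOn`), whose gradient is a Fréchet subgradient. Ordinary calculus thus
replaces sum and quotient rules for subdifferentials. Near a feasible point this gradient is bounded
by the last two steps (`IsIterates.exists_subgradient_bound`).

Continuity: `f / g` is locally Lipschitz on the feasible set, so the merit function at `(a, a)`, for
a cluster point `a`, equals `lim F`, and the KL inequality applies at the right level.

Concavity of `φ` then bounds each step by a telescoping term plus a quarter of the two preceding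
steps, whence finite length (`summable_of_KLAt`). Stationarity follows since the subgradients tend
to `0` and the values converge. An exponent at most `1/2` gives a linear two-step recursion for `F n
- lim F`, hence geometric decay. -/

noncomputable section

namespace EPSG

/-! ### Gradient inequality and descent lemma. -/

section Convexity

variable {E : Type*} [NormedAddCommGroup E] [NormedSpace ℝ E]

/-- The gradient inequality for convex functions. -/
theorem add_fderiv_le_of_convexOn {s : Set E} {φ : E → ℝ} (hφ : ConvexOn ℝ s φ) {x y : E}
    (hx : x ∈ s) (hy : y ∈ s) {L : E →L[ℝ] ℝ} (hL : HasFDerivAt φ L x) :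
    φ x + L (y - x) ≤ φ y := by
  have hline : HasDerivAt (fun t : ℝ => φ (x + t • (y - x))) (L (y - x)) 0 := by
    have h1 : HasDerivAt (fun t : ℝ => x + t • (y - x)) (y - x) 0 := by
      simpa using ((hasDerivAt_id (0 : ℝ)).smul_const (y - x)).const_add x
    have h2 : HasFDerivAt φ L (x + (0 : ℝ) • (y - x)) := by simpa using hL
    exact h2.comp_hasDerivAt (0 : ℝ) h1
  have hslope := hline.tendsto_slope_zero_right
  have hle : ∀ᶠ t : ℝ in 𝓝[>] 0,
      t⁻¹ • (φ (x + (0 + t) • (y - x)) - φ (x + (0 : ℝ) • (y - x))) ≤ φ y - φ x := by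
    filter_upwards [Ioo_mem_nhdsGT (zero_lt_one (α := ℝ))] with t ht
    have hc := hφ.2 hx hy (sub_nonneg.2 ht.2.le) ht.1.le (by ring)
    have he : (1 - t) • x + t • y = x + (0 + t) • (y - x) := by module
    rw [he] at hc
    simp only [smul_eq_mul, zero_smul, add_zero] at hc ⊢
    rw [inv_mul_le_iff₀ ht.1]
    linarith
  have := le_of_tendsto hslope hle
  linarith

end Convexity

section Descent

variable {H : Type*} [NormedAddCommGroup H] [InnerProductSpace ℝ H] [CompleteSpace H]

/-- The descent lemma for functions with Lipschitz continuous gradient. -/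
theorem le_add_inner_gradient_add_sq {φ : H → ℝ} (hφ : Differentiable ℝ φ) {ℓ : ℝ}
    (hlip : ∀ x y, ‖gradient φ x - gradient φ y‖ ≤ ℓ * ‖x - y‖) (x y : H) :
    φ y ≤ φ x + inner ℝ (gradient φ x) (y - x) + ℓ / 2 * ‖y - x‖ ^ 2 := by
  set v := y - x with hv
  have hd : ∀ t : ℝ, HasDerivAt (fun t : ℝ => φ (x + t • v))
      (inner ℝ (gradient φ (x + t • v)) v) t := by
    intro t
    have h1 : HasDerivAt (fun t : ℝ => x + t • v) v t := by
      simpa using ((hasDerivAt_id t).smul_const v).const_add x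
    have h2 := (hφ (x + t • v)).hasGradientAt.hasFDerivAt.comp_hasDerivAt t h1
    refine HasDerivAt.congr_deriv (f := fun t : ℝ => φ (x + t • v)) h2 ?_
    simp
  have hB : ∀ t : ℝ, HasDerivAt
      (fun t : ℝ => φ x + t * inner ℝ (gradient φ x) v + ℓ / 2 * ‖v‖ ^ 2 * t ^ 2)
      (inner ℝ (gradient φ x) v + ℓ * ‖v‖ ^ 2 * t) t := by
    intro t
    have h1 := (((hasDerivAt_id t).mul_const (inner ℝ (gradient φ x) v : ℝ)).const_add
      (φ x)).add (((hasDerivAt_id t).pow 2).const_mul (ℓ / 2 * ‖v‖ ^ 2))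
    refine HasDerivAt.congr_deriv
      (f := fun t : ℝ => φ x + t * inner ℝ (gradient φ x) v + ℓ / 2 * ‖v‖ ^ 2 * t ^ 2) h1 ?_
    simp
    ring
  -- On the segment, `φ` is compared with a quadratic that starts at the same value and has a larger
  -- derivative, which avoids integration.
  have key := image_le_of_deriv_right_le_deriv_boundary (a := 0) (b := 1)
    (f := fun t : ℝ => φ (x + t • v)) (f' := fun t => inner ℝ (gradient φ (x + t • v)) v)
    (fun t _ => (hd t).continuousAt.continuousWithinAt)
    (fun t _ => (hd t).hasDerivWithinAt)
    (B := fun t : ℝ => φ x + t * inner ℝ (gradient φ x) v + ℓ / 2 * ‖v‖ ^ 2 * t ^ 2)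
    (by simp)
    (fun t _ => (hB t).continuousAt.continuousWithinAt)
    (fun t _ => (hB t).hasDerivWithinAt)
    (by
      intro t ht
      have h1 := hlip (x + t • v) x
      rw [add_sub_cancel_left, norm_smul, Real.norm_of_nonneg ht.1] at h1
      have h2 : inner ℝ (gradient φ (x + t • v) - gradient φ x) v ≤ ℓ * (t * ‖v‖) * ‖v‖ :=
        (real_inner_le_norm _ _).trans (mul_le_mul_of_nonneg_right h1 (norm_nonneg _))
      rw [inner_sub_left] at h2
      nlinarith)
    (x := 1) (by simp)
  simp only [one_smul, one_mul, one_pow, mul_one] at key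
  rwa [hv, add_sub_cancel] at key

end Descent

/-! ### Finite length and geometric rates for abstract sequences. -/

section Sequences

variable {X : Type*} [PseudoMetricSpace X]

/-- A sequence with a cluster point around which its steps satisfy
`d (n+2) ≤ e (n+2) - e (n+3) + (d (n+1) + d n) / 4`, with `d` and `e ≥ 0` vanishing at infinity,
has finite length. -/
theorem summable_dist_of_step_le {x : ℕ → X} {a : X} {r : ℝ} (hr : 0 < r) {e : ℕ → ℝ}
    (he : ∀ n, 0 ≤ e n) (he0 : Tendsto e atTop (𝓝 0))
    (hd0 : Tendsto (fun n => dist (x n) (x (n + 1))) atTop (𝓝 0))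
    (ha : MapClusterPt a atTop x) {N : ℕ}
    (hstep : ∀ n ≥ N, dist (x n) a < r → dist (x (n + 1)) a < r → dist (x (n + 2)) a < r →
      dist (x (n + 2)) (x (n + 3)) ≤ e (n + 2) - e (n + 3)
        + (dist (x (n + 1)) (x (n + 2)) + dist (x n) (x (n + 1))) / 4) :
    Summable (fun n => dist (x n) (x (n + 1))) := by
  set d : ℕ → ℝ := fun n => dist (x n) (x (n + 1)) with hd
  have hdn : ∀ n, 0 ≤ d n := fun n => dist_nonneg
  have hsmall : Tendsto (fun n => 3 / 2 * d n + 2 * d (n + 1) + 2 * e (n + 2)) atTop (𝓝 0) := by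
    have h := ((hd0.const_mul (3 / 2)).add
      (((tendsto_add_atTop_iff_nat 1).2 hd0).const_mul 2)).add
      (((tendsto_add_atTop_iff_nat 2).2 he0).const_mul 2)
    simpa using h
  obtain ⟨p, hpa, hpN, hp⟩ : ∃ p, dist (x p) a < r / 2 ∧ N ≤ p ∧
      3 / 2 * d p + 2 * d (p + 1) + 2 * e (p + 2) < r / 2 := by
    have h1 : ∃ᶠ n in atTop, dist (x n) a < r / 2 :=
      ha.frequently (Metric.ball_mem_nhds a (half_pos hr))
    have h2 := hsmall.eventually (gt_mem_nhds (half_pos hr))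
    obtain ⟨p, h3, h4, h5⟩ := (h1.and_eventually ((eventually_ge_atTop N).and h2)).exists
    exact ⟨p, h3, h4, h5⟩
  set P := 3 / 2 * d p + 2 * d (p + 1) + 2 * e (p + 2) with hP
  have hball : ∀ n, ∑ i ∈ Finset.range n, d (p + i) ≤ P → dist (x (p + n)) a < r := by
    intro n hn
    have h1 : dist (x p) (x (p + n)) ≤ ∑ i ∈ Finset.range n, d (p + i) :=
      dist_le_range_sum_dist (fun i => x (p + i)) n
    have h2 := dist_triangle_left (x (p + n)) a (x p)
    linarith
  -- Twice `hstep` says that this left side does not increase with `n`, and at `n = 0` it equals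
  -- `P`. Since `P < r / 2`, the bound on the partial sums keeps the next points in the ball, which
  -- is what allows `hstep` to be used again.
  have hmain : ∀ n, ∑ i ∈ Finset.range (n + 2), d (p + i) + d (p + n + 1) + d (p + n) / 2
      + 2 * e (p + n + 2) ≤ P := by
    intro n
    induction n using Nat.strong_induction_on with
    | _ n ih =>
      rcases n with _ | n
      · simp only [Finset.sum_range_succ, Finset.range_zero, Finset.sum_empty, add_zero, zero_add]
        rw [hP]; linarith
      · have hsum : ∀ k ≤ n + 2, ∑ i ∈ Finset.range k, d (p + i) ≤ P := by
          intro k hk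
          have h1 := ih n (Nat.lt_succ_self n)
          have h2 : ∑ i ∈ Finset.range k, d (p + i) ≤ ∑ i ∈ Finset.range (n + 2), d (p + i) :=
            Finset.sum_le_sum_of_subset_of_nonneg (Finset.range_mono hk) (fun i _ _ => hdn _)
          linarith [hdn (p + n + 1), hdn (p + n), he (p + n + 2)]
        have hs := hstep (p + n) (by omega) (hball n (hsum n (by omega)))
          (hball (n + 1) (hsum _ (by omega))) (hball (n + 2) (hsum _ le_rfl))
        have hi := ih n (Nat.lt_succ_self n)
        rw [Finset.sum_range_succ]
        change d (p + n + 2) ≤ e (p + n + 2) - e (p + n + 3)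
          + (d (p + n + 1) + d (p + n)) / 4 at hs
        have e1 : p + (n + 1 + 1) = p + n + 2 := by omega
        have e2 : p + (n + 1) + 1 = p + n + 2 := by omega
        have e3 : p + (n + 1) = p + n + 1 := by omega
        have e4 : p + (n + 1) + 2 = p + n + 3 := by omega
        rw [e1, e4, e2, e3]
        linarith
  rw [← summable_nat_add_iff p]
  refine summable_of_sum_range_le (c := P) (fun n => hdn _) (fun n => ?_)
  have h1 := hmain n
  have h2 : ∑ i ∈ Finset.range n, d (p + i) ≤ ∑ i ∈ Finset.range (n + 2), d (p + i) :=
    Finset.sum_le_sum_of_subset_of_nonneg (Finset.range_mono (by omega)) (fun i _ _ => hdn _)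
  have h3 : ∑ i ∈ Finset.range n, d (i + p) = ∑ i ∈ Finset.range n, d (p + i) :=
    Finset.sum_congr rfl fun i _ => by rw [add_comm]
  linarith [hdn (p + n + 1), hdn (p + n), he (p + n + 2)]

/-- A two-step linear recursion forces geometric decay. -/
theorem exists_le_geometric_of_two_step {r : ℕ → ℝ} (hr : ∀ n, 0 ≤ r n) (hanti : Antitone r)
    {K : ℝ} (hK : 0 < K) {N : ℕ} (h : ∀ n ≥ N, r (n + 2) ≤ K * (r n - r (n + 2))) :
    ∃ γ > (0 : ℝ), ∃ ρ ∈ Ioo (0 : ℝ) 1, ∀ n, r n ≤ γ * ρ ^ n := by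
  set q := K / (1 + K) with hq
  have hq0 : 0 < q := by positivity
  have hq1 : q < 1 := by rw [hq, div_lt_one (by positivity)]; linarith
  have hstep : ∀ n ≥ N, r (n + 2) ≤ q * r n := by
    intro n hn
    have := h n hn
    rw [hq, div_mul_eq_mul_div, le_div_iff₀ (by positivity)]
    linarith
  set ρ := √q with hρ
  have hρ0 : 0 < ρ := Real.sqrt_pos.2 hq0
  have hρ1 : ρ < 1 := by rw [hρ, Real.sqrt_lt' one_pos]; simpa using hq1
  have hρ2 : ρ ^ 2 = q := Real.sq_sqrt hq0.le
  -- The recursion advances by two, so two consecutive indices are carried. The factor `ρ` on the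
  -- left compensates for the step from `N` to `N + 1`, where only monotonicity is available.
  have htail : ∀ k, r (N + k) * ρ ≤ r N * ρ ^ k ∧ r (N + (k + 1)) * ρ ≤ r N * ρ ^ (k + 1) := by
    intro k
    induction k with
    | zero =>
      refine ⟨by simpa using mul_le_of_le_one_right (hr N) hρ1.le, ?_⟩
      simpa using mul_le_mul_of_nonneg_right (hanti (Nat.le_succ N)) hρ0.le
    | succ k ih =>
      refine ⟨ih.2, ?_⟩
      have h1 := hstep (N + k) (by omega)
      calc r (N + (k + 1 + 1)) * ρ ≤ q * r (N + k) * ρ := mul_le_mul_of_nonneg_right h1 hρ0.le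
        _ = q * (r (N + k) * ρ) := by ring
        _ ≤ q * (r N * ρ ^ k) := mul_le_mul_of_nonneg_left ih.1 hq0.le
        _ = r N * ρ ^ (k + 1 + 1) := by rw [← hρ2]; ring
  -- The `+ 1` keeps the constant positive if `r 0 = 0`; the power of `ρ` covers the indices before
  -- `N` and the extra factor in `htail`.
  refine ⟨(r 0 + 1) / ρ ^ (N + 1), div_pos (by linarith [hr 0]) (by positivity), ρ,
    ⟨hρ0, hρ1⟩, fun n => ?_⟩
  rw [div_mul_eq_mul_div, le_div_iff₀ (by positivity)]
  rcases le_total N n with hn | hn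
  · obtain ⟨k, rfl⟩ := Nat.exists_eq_add_of_le hn
    have h1 : r N ≤ r 0 + 1 := by linarith [hanti (Nat.zero_le N)]
    calc r (N + k) * ρ ^ (N + 1) = r (N + k) * ρ * ρ ^ N := by ring
      _ ≤ r N * ρ ^ k * ρ ^ N := mul_le_mul_of_nonneg_right (htail k).1 (by positivity)
      _ ≤ (r 0 + 1) * ρ ^ k * ρ ^ N := by gcongr
      _ = _ := by ring
  · have h1 : r n ≤ r 0 + 1 := by linarith [hanti (Nat.zero_le n)]
    have h2 : ρ ^ (N + 1) ≤ ρ ^ n := pow_le_pow_of_le_one hρ0.le hρ1.le (by omega)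
    exact mul_le_mul h1 h2 (by positivity) (by linarith [hr 0])

/-- If the squared steps of a convergent sequence decay like `ρ ^ n`, the sequence converges like
`ρ ^ (n / 2)`. -/
theorem exists_dist_le_geometric_of_sq_le {x : ℕ → X} {a : X} (hx : Tendsto x atTop (𝓝 a))
    {γ ρ : ℝ} (hγ : 0 < γ) (hρ : ρ ∈ Ioo (0 : ℝ) 1)
    (h : ∀ n, dist (x n) (x (n + 1)) ^ 2 ≤ γ * ρ ^ n) :
    ∃ γ' > (0 : ℝ), ∀ n : ℕ, dist (x n) a ≤ γ' * ρ ^ ((n : ℝ) / 2) := by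
  have h0 : 0 < √ρ := Real.sqrt_pos.2 hρ.1
  have h1 : √ρ < 1 := by rw [Real.sqrt_lt' one_pos]; simpa using hρ.2
  have hstep : ∀ n, dist (x n) (x (n + 1)) ≤ √γ * √ρ ^ n := by
    intro n
    refine abs_le_of_sq_le_sq' ?_ (by positivity) |>.2
    rw [mul_pow, ← pow_mul, mul_comm n 2, pow_mul, Real.sq_sqrt hγ.le, Real.sq_sqrt hρ.1.le]
    exact h n
  refine ⟨√γ / (1 - √ρ), div_pos (Real.sqrt_pos.2 hγ) (by linarith), fun n => ?_⟩
  have h2 := dist_le_of_le_geometric_of_tendsto _ _ h1 hstep hx n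
  have h3 : ρ ^ ((n : ℝ) / 2) = √ρ ^ n := by
    rw [Real.sqrt_eq_rpow, ← Real.rpow_natCast, ← Real.rpow_mul hρ.1.le]
    congr 1; ring
  rw [h3]
  calc _ ≤ _ := h2
    _ = _ := by ring

end Sequences

/-- The basic step of a Kurdyka–Łojasiewicz argument. -/
theorem le_of_sq_le_of_one_le_mul {d s a b p Δ δ : ℝ} (ha : 0 < a) (hb : 0 < b)
    (hp : 0 < p) (hs : 0 ≤ s) (hδ : a * d ^ 2 ≤ δ) (hΔ : p * δ ≤ Δ) (hkl : 1 ≤ p * (b * s)) :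
    d ≤ b / a * Δ + s / 4 := by
  have hdΔ : a * d ^ 2 ≤ Δ * (b * s) := by
    have h0 : 0 ≤ a * d ^ 2 := by positivity
    have h1 : a * d ^ 2 ≤ δ * (p * (b * s)) := by nlinarith
    calc _ ≤ _ := h1
      _ = p * δ * (b * s) := by ring
      _ ≤ _ := mul_le_mul_of_nonneg_right hΔ (by positivity)
  have hΔ0 : 0 ≤ Δ := le_trans (mul_nonneg hp.le (le_trans (by positivity) hδ)) hΔ
  have h2 : d ^ 2 ≤ (b / a * Δ) * s := by
    rw [show b / a * Δ * s = Δ * (b * s) / a by ring, le_div_iff₀ ha]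
    linarith
  have h3 : 0 ≤ b / a * Δ := by positivity
  refine (abs_le_of_sq_le_sq' ?_ (by positivity)).2
  -- With `X = (b / a) Δ` one has `d² ≤ X s` and `(X + s/4)² - X s = (X - s/4)²`.
  nlinarith [sq_nonneg (b / a * Δ - s / 4)]

/-- Desingularizing functions lie below their tangents. -/
theorem Desingularizing.deriv_mul_sub_le {η : EReal} {φ : ℝ → ℝ} (hφ : Desingularizing η φ)
    {s t : ℝ} (hs : 0 < s) (hsη : (s : EReal) < η) (ht : 0 ≤ t) (hts : t ≤ s) :
    deriv φ s * (s - t) ≤ φ s - φ t := by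
  rcases hts.eq_or_lt with rfl | hlt
  · simp
  have hopen : IsOpen {s : ℝ | 0 < s ∧ (s : EReal) < η} :=
    (isOpen_lt continuous_const continuous_id).inter
      (isOpen_lt continuous_coe_real_ereal continuous_const)
  have hdiff : DifferentiableAt ℝ φ s :=
    (hφ.contDiffOn.differentiableOn one_ne_zero).differentiableAt (hopen.mem_nhds ⟨hs, hsη⟩)
  have h1 := hφ.concaveOn.deriv_le_slope (x := t) (y := s)
    ⟨ht, lt_of_le_of_lt (EReal.coe_le_coe_iff.2 hts) hsη⟩ ⟨hs.le, hsη⟩ hlt hdiff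
  rwa [slope_def_field, le_div_iff₀ (sub_pos.2 hlt)] at h1

/-! ### Fréchet and limiting subgradients of smooth functions. -/

section Subdifferential

variable {E : Type*} [NormedAddCommGroup E] [InnerProductSpace ℝ E]

theorem mem_frechetSubdiff_iff {h : E → EReal} {x u : E} :
    u ∈ frechetSubdiff h x ↔ FiniteAt h x ∧ ∀ a : EReal, a < 0 → ∀ᶠ z in 𝓝[≠] x,
      a < (h z - h x - ((inner ℝ u (z - x) : ℝ) : EReal)) / ((‖z - x‖ : ℝ) : EReal) := by
  rw [frechetSubdiff, mem_ofPred_eq, le_liminf_iff]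

/-- The gradient of a differentiable minorant that touches `h` at `x` is a Fréchet subgradient. -/
theorem mem_frechetSubdiff_of_minorant {h : E → EReal} {R : E → ℝ} {x u : E}
    (hx : h x = (R x : EReal)) (hle : ∀ᶠ z in 𝓝 x, (R z : EReal) ≤ h z)
    (hR : HasFDerivAt R (innerSL ℝ u) x) : u ∈ frechetSubdiff h x := by
  refine mem_frechetSubdiff_iff.2 ⟨⟨by simp [hx], by simp [hx]⟩, fun a ha => ?_⟩
  obtain ⟨b, hab, hb⟩ := EReal.lt_iff_exists_real_btwn.1 ha
  have hb0 : b < 0 := by exact_mod_cast hb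
  have hlo := (hasFDerivAt_iff_isLittleO.1 hR).def (neg_pos.2 hb0)
  filter_upwards [nhdsWithin_le_nhds hlo, nhdsWithin_le_nhds hle, self_mem_nhdsWithin]
    with z hz hzle hzx
  have hpos : 0 < ‖z - x‖ := norm_pos_iff.2 (sub_ne_zero.2 hzx)
  rw [Real.norm_eq_abs, innerSL_apply_apply] at hz
  have h1 : b ≤ (R z - R x - inner ℝ u (z - x)) / ‖z - x‖ := by
    rw [le_div_iff₀ hpos]
    have := neg_abs_le (R z - R x - inner ℝ u (z - x))
    linarith
  refine hab.trans_le ((EReal.coe_le_coe_iff.2 h1).trans ?_)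
  rw [EReal.coe_div, EReal.coe_sub, EReal.coe_sub, hx]
  exact EReal.div_le_div_right_of_nonneg (by exact_mod_cast hpos.le)
    (EReal.sub_le_sub (EReal.sub_le_sub hzle le_rfl) le_rfl)

/-- Along the ray from `x` in the direction `u - v`, the subgradient inequality and
differentiability force `t‖u - v‖² ≤ 2εt‖u - v‖` for some small `t > 0`. -/
theorem eq_of_mem_frechetSubdiff {h : E → EReal} {φ : E → ℝ} {x u v : E}
    (hφ : ∀ᶠ z in 𝓝 x, h z = (φ z : EReal)) (hd : HasFDerivAt φ (innerSL ℝ v) x)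
    (hu : u ∈ frechetSubdiff h x) : u = v := by
  have hx : h x = (φ x : EReal) := hφ.self_of_nhds
  have hkey : ∀ ε > (0 : ℝ), ‖u - v‖ ≤ 2 * ε := by
    intro ε hε
    have h1 := (mem_frechetSubdiff_iff.1 hu).2 ((-ε : ℝ) : EReal)
      (by exact_mod_cast neg_lt_zero.2 hε)
    have h2 := (hasFDerivAt_iff_isLittleO.1 hd).def hε
    rw [eventually_nhdsWithin_iff] at h1
    by_cases huv : u - v = 0
    · rw [huv, norm_zero]; positivity
    have hpos : 0 < ‖u - v‖ := norm_pos_iff.2 huv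
    have hlim : Tendsto (fun t : ℝ => x + t • (u - v)) (𝓝[>] 0) (𝓝 x) := by
      have : Continuous fun t : ℝ => x + t • (u - v) := by fun_prop
      simpa using (this.tendsto 0).mono_left nhdsWithin_le_nhds
    obtain ⟨t, ⟨ht1, ht2, ht3⟩, ht0⟩ := ((hlim.eventually (h1.and (h2.and hφ))).and
      self_mem_nhdsWithin).exists
    have ht0 : 0 < t := ht0
    have hne : x + t • (u - v) ∈ ({x}ᶜ : Set E) := by
      simp [ht0.ne', huv]
    have ht1 := ht1 hne
    rw [add_sub_cancel_left] at ht1 ht2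
    rw [ht3, hx, norm_smul, Real.norm_of_nonneg ht0.le, ← EReal.coe_sub, ← EReal.coe_sub,
      ← EReal.coe_div, EReal.coe_lt_coe_iff, lt_div_iff₀ (by positivity), inner_smul_right] at ht1
    rw [Real.norm_eq_abs, innerSL_apply_apply, norm_smul, Real.norm_of_nonneg ht0.le,
      inner_smul_right] at ht2
    have h3 := (le_abs_self _).trans ht2
    have h4 : inner ℝ u (u - v) - inner ℝ v (u - v) = ‖u - v‖ ^ 2 := by
      rw [← inner_sub_left, real_inner_self_eq_norm_sq]
    have h5 : t * ‖u - v‖ * ‖u - v‖ ≤ t * ‖u - v‖ * (2 * ε) := by nlinarith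
    exact le_of_mul_le_mul_left h5 (by positivity)
  rw [← sub_eq_zero, ← norm_le_zero_iff]
  refine le_of_forall_pos_le_add fun ε hε => ?_
  have := hkey (ε / 2) (by positivity)
  linarith

theorem frechetSubdiff_subset_limitingSubdiff (h : E → EReal) (x : E) :
    frechetSubdiff h x ⊆ limitingSubdiff h x := fun u hu =>
  ⟨hu.1, fun _ => x, fun _ => u, tendsto_const_nhds, tendsto_const_nhds, tendsto_const_nhds,
    fun _ => hu⟩

variable [CompleteSpace E]

theorem ContDiffFnOn.hasFDerivAt {U : Set E} {h : E → EReal} (hh : ContDiffFnOn U h)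
    (hU : IsOpen U) {x : E} (hx : x ∈ U) :
    HasFDerivAt (fun p => (h p).toReal) (innerSL ℝ (gradient (fun p => (h p).toReal) x)) x :=
  ((hh.2.differentiableOn one_ne_zero).differentiableAt
    (hU.mem_nhds hx)).hasGradientAt.hasFDerivAt

/-- The limiting subdifferential of a continuously differentiable function is its gradient. -/
theorem ContDiffFnOn.eq_gradient {U : Set E} {h : E → EReal} (hh : ContDiffFnOn U h)
    (hU : IsOpen U) {x u : E} (hx : x ∈ U) (hu : u ∈ limitingSubdiff h x) :
    u = gradient (fun p => (h p).toReal) x := by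
  obtain ⟨-, y, v, hy, -, hv, hyv⟩ := hu
  have hcont : ContinuousAt (gradient fun p => (h p).toReal) x :=
    (InnerProductSpace.toDual ℝ E).symm.continuous.continuousAt.comp
      ((hh.2.continuousOn_fderiv_of_isOpen hU le_rfl).continuousAt (hU.mem_nhds hx))
  have heq : ∀ᶠ n in atTop, v n = gradient (fun p => (h p).toReal) (y n) := by
    filter_upwards [hy.eventually (hU.mem_nhds hx)] with n hn
    refine eq_of_mem_frechetSubdiff ?_ (hh.hasFDerivAt hU hn) (hyv n)
    filter_upwards [hU.mem_nhds hn] with z hz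
    exact (EReal.coe_toReal (hh.1 z hz).1 (hh.1 z hz).2).symm
  exact tendsto_nhds_unique hv ((hcont.tendsto.comp hy).congr' (heq.mono fun _ h => h.symm))

end Subdifferential

/-! ### From extended-valued weak convexity to real-valued convexity. -/

section WeakConvexity

variable {E : Type*} [NormedAddCommGroup E] [InnerProductSpace ℝ E]

theorem WeaklyConvexOn.convexOn_toReal {A S : Set E} {h : E → EReal} {ρ : ℝ}
    (hh : WeaklyConvexOn A h ρ) (hSA : S ⊆ A) (hS : Convex ℝ S)
    (hfin : ∀ x ∈ S, FiniteAt h x) :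
    ConvexOn ℝ S (fun x => (h x).toReal + ρ / 2 * ‖x‖ ^ 2) := by
  have hval : ∀ x ∈ S, restrict A (fun x => h x + ((ρ / 2 * ‖x‖ ^ 2 : ℝ) : EReal)) x
      = (((h x).toReal + ρ / 2 * ‖x‖ ^ 2 : ℝ) : EReal) := by
    intro x hx
    rw [restrict, if_pos (hSA hx), EReal.coe_add, EReal.coe_toReal (hfin x hx).1 (hfin x hx).2]
  refine ⟨hS, fun x hx y hy a b ha hb hab => ?_⟩
  have h1 := hh (x := (x, (h x).toReal + ρ / 2 * ‖x‖ ^ 2)) (hval x hx).le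
    (y := (y, (h y).toReal + ρ / 2 * ‖y‖ ^ 2)) (hval y hy).le ha hb hab
  have h2 := (hval _ (hS hx hy ha hb hab)).symm.trans_le h1
  exact EReal.coe_le_coe_iff.1 h2

end WeakConvexity

/-! ### The ratio and the merit function on the feasible set. -/

section Program

variable {H : Type*} [NormedAddCommGroup H] [InnerProductSpace ℝ H]
  {S : Set H} {f : H → EReal} {fs : H → ℝ} {fn g fl : H → EReal} {C : Set H} {ℓ β c : ℝ}

theorem hasFDerivAt_add_mul_dist_sq {R : H → ℝ} {x y q : H}
    (hR : HasFDerivAt R (innerSL ℝ q) x) (c : ℝ) :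
    HasFDerivAt (fun z : WithLp 2 (H × H) => R z.fst + c * ‖z.fst - z.snd‖ ^ 2)
      (innerSL ℝ (WithLp.toLp 2 (q + (2 * c) • (x - y), -((2 * c) • (x - y)))))
      (WithLp.toLp 2 (x, y)) := by
  have h1 : HasFDerivAt (fun z : WithLp 2 (H × H) => z.fst)
      (WithLp.fstL 2 ℝ H H) (WithLp.toLp 2 (x, y)) := (WithLp.fstL 2 ℝ H H).hasFDerivAt
  have h2 : HasFDerivAt (fun z : WithLp 2 (H × H) => z.snd)
      (WithLp.sndL 2 ℝ H H) (WithLp.toLp 2 (x, y)) := (WithLp.sndL 2 ℝ H H).hasFDerivAt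
  have h3 : HasFDerivAt (fun z : WithLp 2 (H × H) => R z.fst)
      ((innerSL ℝ q).comp (WithLp.fstL 2 ℝ H H)) (WithLp.toLp 2 (x, y)) :=
    HasFDerivAt.comp (g := R) (WithLp.toLp 2 (x, y)) hR h1
  have h4 := h3.add (((h1.sub h2).norm_sq).const_mul c)
  refine h4.congr_fderiv ?_
  ext v
  simp [WithLp.prod_inner_apply, inner_add_left, inner_smul_left, inner_sub_left]
  ring

/-- The quadratic coupling is smooth, so adding it to a smooth minorant `R` of the ratio gives a
smooth minorant of the merit function. -/
theorem mem_frechetSubdiff_meritFn {R : H → ℝ} {x q : H}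
    (hx : ratioFn S f g x = (R x : EReal)) (hle : ∀ᶠ z in 𝓝 x, (R z : EReal) ≤ ratioFn S f g z)
    (hR : HasFDerivAt R (innerSL ℝ q) x) (c : ℝ) (y : H) :
    WithLp.toLp 2 (q + (2 * c) • (x - y), -((2 * c) • (x - y)))
      ∈ frechetSubdiff (meritFn S f g c) (WithLp.toLp 2 (x, y)) := by
  refine mem_frechetSubdiff_of_minorant (R := fun z => R z.fst + c * ‖z.fst - z.snd‖ ^ 2)
    ?_ ?_ (hasFDerivAt_add_mul_dist_sq hR c)
  · rw [meritFn, EReal.coe_add]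
    exact congrArg (· + _) hx
  · have hlim : Tendsto (fun z : WithLp 2 (H × H) => z.fst) (𝓝 (WithLp.toLp 2 (x, y))) (𝓝 x) :=
      (WithLp.fstL 2 ℝ H H).continuous.tendsto _
    filter_upwards [hlim.eventually hle] with z hz
    rw [meritFn, EReal.coe_add]
    exact add_le_add_left hz _

theorem norm_meritFn_subgradient_le (q d : H) {c : ℝ} (hc : 0 ≤ c) :
    ‖WithLp.toLp 2 (q + (2 * c) • d, -((2 * c) • d))‖ ≤ ‖q‖ + 4 * c * ‖d‖ := by
  rw [WithLp.prod_norm_eq_of_L2]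
  refine (Real.sqrt_le_left (by positivity)).2 ?_
  have h1 : ‖q + (2 * c) • d‖ ≤ ‖q‖ + 2 * c * ‖d‖ := by
    refine (norm_add_le _ _).trans ?_
    rw [norm_smul, Real.norm_of_nonneg (by positivity)]
  have h2 : ‖-((2 * c) • d)‖ = 2 * c * ‖d‖ := by
    rw [norm_neg, norm_smul, Real.norm_of_nonneg (by positivity)]
  change ‖q + (2 * c) • d‖ ^ 2 + ‖-((2 * c) • d)‖ ^ 2 ≤ _
  rw [h2]
  have h3 := pow_le_pow_left₀ (norm_nonneg _) h1 2
  nlinarith [norm_nonneg q, mul_nonneg hc (norm_nonneg d),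
    mul_nonneg (norm_nonneg q) (mul_nonneg hc (norm_nonneg d))]

theorem DenominatorAssumption.finiteAt (hg : DenominatorAssumption S g β) {x : H} (hx : x ∈ S) :
    FiniteAt g x := ⟨(hg.finite x hx).ne, hg.proper.2 x⟩

theorem DenominatorAssumption.coe_toReal (hg : DenominatorAssumption S g β) {x : H}
    (hx : x ∈ S) : ((g x).toReal : EReal) = g x :=
  EReal.coe_toReal (hg.finiteAt hx).1 (hg.finiteAt hx).2

theorem DenominatorAssumption.toReal_pos (hg : DenominatorAssumption S g β) {x : H}
    (hx : x ∈ S) : 0 < (g x).toReal := by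
  have := hg.pos x hx
  rw [← hg.coe_toReal hx] at this
  exact_mod_cast this

theorem DenominatorAssumption.continuousOn_toReal (hg : DenominatorAssumption S g β) :
    ContinuousOn (fun x => (g x).toReal) S := by
  obtain ⟨U, -, hSU, hU⟩ := hg.continuous
  intro x hx
  exact (EReal.tendsto_toReal (hg.finiteAt hx).1 (hg.finiteAt hx).2).comp
    ((hU.mono hSU) x hx)

theorem DenominatorAssumption.convexOn (hg : DenominatorAssumption S g β) (hS : Convex ℝ S) :
    ConvexOn ℝ S (fun x => (g x).toReal + β / 2 * ‖x‖ ^ 2) := by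
  rcases hg.weaklyConvex with ⟨O, -, -, hSO, h⟩ | ⟨-, h⟩
  · exact h.convexOn_toReal hSO hS fun x hx => hg.finiteAt hx
  · exact h.convexOn_toReal subset_rfl hS fun x hx => hg.finiteAt hx

/-- The subgradient inequality for a weakly convex denominator. -/
theorem DenominatorAssumption.inner_le (hg : DenominatorAssumption S g β) (hS : Convex ℝ S)
    {x y u : H} (hx : x ∈ S) (hy : y ∈ S)
    (hu : HasFDerivAt (fun p => (g p).toReal) (innerSL ℝ u) x) :
    inner ℝ u (y - x) ≤ (g y).toReal - (g x).toReal + β / 2 * ‖y - x‖ ^ 2 := by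
  have h1 : HasFDerivAt (fun z : H => ‖z‖ ^ 2) _ x := (hasFDerivAt_id x).norm_sq
  have h2 := add_fderiv_le_of_convexOn (hg.convexOn hS) hx hy (hu.add (h1.const_mul (β / 2)))
  have h3 : ‖y - x‖ ^ 2 = ‖y‖ ^ 2 - ‖x‖ ^ 2 - 2 * inner ℝ x (y - x) := by
    rw [inner_sub_right, real_inner_self_eq_norm_sq, norm_sub_sq_real, real_inner_comm]
    ring
  simp at h2
  rw [h3]
  simp only [inner_sub_right] at h2 ⊢
  linarith

/-- `A` lies in a compact part of `S`, where `g` is continuous. This supplies an upper bound of `g`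
when the boundedness condition does not. -/
theorem exists_bound_of_isBounded [ProperSpace H] (hg : DenominatorAssumption S g β)
    (hS : IsClosed S) {A : Set H} (hA : Bornology.IsBounded A) (hAS : A ⊆ S) :
    ∃ M > (0 : ℝ), ∀ y ∈ A, (g y).toReal ≤ M := by
  obtain ⟨R, hR⟩ := hA.subset_closedBall 0
  have hK : IsCompact (S ∩ Metric.closedBall (0 : H) R) :=
    (isCompact_closedBall 0 R).inter_left hS
  obtain ⟨M, hM⟩ := hK.bddAbove_image (hg.continuousOn_toReal.mono inter_subset_left)
  refine ⟨max M 1, by positivity, fun y hy => ?_⟩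
  exact (hM ⟨y, ⟨hAS hy, hR hy⟩, rfl⟩).trans (le_max_left _ _)

/-- On `S` off `dom f` the quotient is `⊤` divided by a positive finite number. Minorants of the
ratio therefore need checking at feasible points only. -/
theorem ratioFn_of_notMem (hg : DenominatorAssumption S g β) {x : H} (hx : x ∉ S ∩ dom f) :
    ratioFn S f g x = ⊤ := by
  rw [ratioFn, restrict]
  split_ifs with hxS
  · have h1 : f x = ⊤ := not_lt_top_iff.1 fun h => hx ⟨hxS, h⟩
    rw [h1, EReal.top_div_of_pos_ne_top (hg.pos x hxS) (hg.finite x hxS).ne]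
  · rfl

variable [CompleteSpace H]

theorem NumeratorAssumption.coe_toReal (hf : NumeratorAssumption S f fs fn ℓ) {x : H}
    (hx : x ∈ S ∩ dom f) : ((f x).toReal : EReal) = f x :=
  EReal.coe_toReal hx.2.ne (fun h => by simpa [h] using hf.nonneg x hx)

theorem NumeratorAssumption.toReal_nonneg (hf : NumeratorAssumption S f fs fn ℓ) {x : H}
    (hx : x ∈ S ∩ dom f) : 0 ≤ (f x).toReal := EReal.toReal_nonneg (hf.nonneg x hx)

theorem NumeratorAssumption.mem_dom_iff (hf : NumeratorAssumption S f fs fn ℓ) {x : H} :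
    x ∈ dom f ↔ fn x < ⊤ := by
  rw [dom, mem_ofPred_eq, hf.sum_eq x]
  constructor
  · intro h
    by_contra h'
    rw [not_lt_top_iff.1 h'] at h
    simp at h
  · exact fun h => EReal.add_lt_top (EReal.coe_ne_top _) h.ne

theorem NumeratorAssumption.coe_toReal_fn (hf : NumeratorAssumption S f fs fn ℓ) {x : H}
    (hx : x ∈ dom f) : ((fn x).toReal : EReal) = fn x :=
  EReal.coe_toReal (hf.mem_dom_iff.1 hx).ne (hf.proper.2 x)

theorem NumeratorAssumption.toReal_eq (hf : NumeratorAssumption S f fs fn ℓ) {x : H}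
    (hx : x ∈ dom f) : (f x).toReal = fs x + (fn x).toReal := by
  rw [hf.sum_eq x, EReal.toReal_add (EReal.coe_ne_top _) (EReal.coe_ne_bot _)
    (hf.mem_dom_iff.1 hx).ne (hf.proper.2 x), EReal.toReal_coe]

theorem theta_eq (f g : H → EReal) (hf : NumeratorAssumption S f fs fn ℓ)
    (hg : DenominatorAssumption S g β) {x : H} (hx : x ∈ S ∩ dom f) :
    theta f g x = (f x).toReal / (g x).toReal := by
  rw [theta, ← hf.coe_toReal hx, ← hg.coe_toReal hx.1, ← EReal.coe_div]
  simp

theorem div_eq_coe_theta (hf : NumeratorAssumption S f fs fn ℓ)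
    (hg : DenominatorAssumption S g β) {x : H} (hx : x ∈ S ∩ dom f) :
    f x / g x = (theta f g x : EReal) := by
  rw [theta_eq f g hf hg hx, EReal.coe_div, hf.coe_toReal hx, hg.coe_toReal hx.1]

theorem ratioFn_of_mem (hf : NumeratorAssumption S f fs fn ℓ)
    (hg : DenominatorAssumption S g β) {x : H} (hx : x ∈ S ∩ dom f) :
    ratioFn S f g x = (theta f g x : EReal) := by
  rw [ratioFn, restrict, if_pos hx.1, div_eq_coe_theta hf hg hx]

theorem theta_nonneg (hf : NumeratorAssumption S f fs fn ℓ)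
    (hg : DenominatorAssumption S g β) {x : H} (hx : x ∈ S ∩ dom f) : 0 ≤ theta f g x := by
  rw [theta_eq f g hf hg hx]
  exact div_nonneg (hf.toReal_nonneg hx) (hg.toReal_pos hx.1).le

theorem meritFn_of_mem (hf : NumeratorAssumption S f fs fn ℓ)
    (hg : DenominatorAssumption S g β) {x : H} (hx : x ∈ S ∩ dom f) (c : ℝ) (y : H) :
    meritFn S f g c (WithLp.toLp 2 (x, y)) = ((theta f g x + c * ‖x - y‖ ^ 2 : ℝ) : EReal) := by
  rw [EReal.coe_add, ← ratioFn_of_mem hf hg hx]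
  rfl

/-- The nonsmooth part of the numerator is locally Lipschitz continuous on the feasible set. -/
theorem NonsmoothAssumption.exists_lipschitz (hfn : NonsmoothAssumption S f fn g fl C)
    (hf : NumeratorAssumption S f fs fn ℓ) {x : H} (hx : x ∈ S ∩ dom f) :
    ∃ K ≥ (0 : ℝ), ∃ V ∈ 𝓝 x, ∀ y ∈ V ∩ (S ∩ dom f), ∀ z ∈ V ∩ (S ∩ dom f),
      |(f y).toReal - (f z).toReal| ≤ K * ‖y - z‖ := by
  obtain ⟨K, V, hV, hK⟩ : ∃ K, ∃ V ∈ 𝓝 x, LipschitzOnWith K (fun p => (fl p).toReal) V := by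
    have hloc : ∀ U : Set H, IsOpen U → x ∈ U → LocLipOn U fl →
        ∃ K, ∃ V ∈ 𝓝 x, LipschitzOnWith K (fun p => (fl p).toReal) V := by
      intro U hU hxU h
      obtain ⟨K, V, hV, hK⟩ := h.2 hxU
      exact ⟨K, V, by rwa [hU.nhdsWithin_eq hxU] at hV, hK⟩
    rcases hfn.cases with ⟨h, -, -⟩ | ⟨⟨U, hU, hDU, h⟩, -, -⟩ | ⟨⟨U, hU, hDU, h⟩, -⟩
    · exact hloc univ isOpen_univ (mem_univ x) h
    · exact hloc U hU (hDU hx) h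
    · obtain ⟨L, hL⟩ := h.2 x (hDU hx)
      exact hL.exists_lipschitzOnWith
  obtain ⟨K', V', hV', hK'⟩ := (hf.smooth.contDiffAt (x := x)).exists_lipschitzOnWith
  have hfl : ∀ y ∈ dom f, fn y = fl y := by
    intro y hy
    have h1 := hf.mem_dom_iff.1 hy
    rw [hfn.eq, restrict] at h1 ⊢
    split_ifs with hC
    · rfl
    · simp [hC] at h1
  refine ⟨K' + K, by positivity, V ∩ V', inter_mem hV hV', ?_⟩
  rintro y ⟨⟨hyV, hyV'⟩, -, hyf⟩ z ⟨⟨hzV, hzV'⟩, -, hzf⟩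
  have h1 := hK.dist_le_mul y hyV z hzV
  have h2 := hK'.dist_le_mul y hyV' z hzV'
  rw [Real.dist_eq, dist_eq_norm] at h1 h2
  rw [hf.toReal_eq hyf, hf.toReal_eq hzf, hfl y hyf, hfl z hzf]
  calc |fs y + (fl y).toReal - (fs z + (fl z).toReal)|
      = |(fs y - fs z) + ((fl y).toReal - (fl z).toReal)| := by congr 1; ring
    _ ≤ K' * ‖y - z‖ + K * ‖y - z‖ := (abs_add_le _ _).trans (add_le_add h2 h1)
    _ = _ := by ring

end Program

/-! ### One step of the algorithm: decrease, subgradient, local bounds. -/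

section Step

variable {H : Type*} [NormedAddCommGroup H] [InnerProductSpace ℝ H] [CompleteSpace H]
  {S : Set H} {f : H → EReal} {fs : H → ℝ} {fn g fl : H → EReal} {C : Set H} {ℓ β c : ℝ}

/-- The smooth real part of the subproblem. -/
def smoothModel (fs : H → ℝ) (ℓ τ θ : ℝ) (w u v y : H) : ℝ :=
  fs u + inner ℝ (gradient fs u) (y - u)
    + 1 / (2 * τ) * ‖y - v - (τ * θ) • w‖ ^ 2 + ℓ / 2 * ‖y - u‖ ^ 2

theorem hasFDerivAt_smoothModel (fs : H → ℝ) (ℓ τ θ : ℝ) (w u v y : H) :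
    HasFDerivAt (smoothModel fs ℓ τ θ w u v)
      (innerSL ℝ (gradient fs u + (1 / τ) • (y - v - (τ * θ) • w) + ℓ • (y - u))) y := by
  have h1 : HasFDerivAt (fun y : H => y - u) (ContinuousLinearMap.id ℝ H) y :=
    (hasFDerivAt_id y).sub_const u
  have h2 : HasFDerivAt (fun y : H => y - v - (τ * θ) • w) (ContinuousLinearMap.id ℝ H) y :=
    ((hasFDerivAt_id y).sub_const v).sub_const _
  have h3 : HasFDerivAt (fun y : H => (inner ℝ (gradient fs u) (y - u) : ℝ))
      (innerSL ℝ (gradient fs u)) y :=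
    (innerSL ℝ (gradient fs u)).hasFDerivAt.comp y h1
  have h4 := ((h3.const_add (fs u)).add (h2.norm_sq.const_mul (1 / (2 * τ)))).add
    (h1.norm_sq.const_mul (ℓ / 2))
  refine HasFDerivAt.congr_fderiv (f := smoothModel fs ℓ τ θ w u v) h4 ?_
  ext p
  simp
  ring

/-- Minimality in the subproblem, in terms of real numbers. -/
theorem NumeratorAssumption.le_of_isMinOn (hf : NumeratorAssumption S f fs fn ℓ)
    {τ θ : ℝ} {w u v y : H} (hy : y ∈ S ∩ dom f)
    (hmin : IsMinOn (subproblem fs fn ℓ τ θ w u v) S y) {z : H} (hz : z ∈ S ∩ dom f) :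
    (fn y).toReal + smoothModel fs ℓ τ θ w u v y
      ≤ (fn z).toReal + smoothModel fs ℓ τ θ w u v z := by
  have h := hmin hz.1
  simp only [mem_ofPred_eq, subproblem] at h
  rw [← hf.coe_toReal_fn hy.2, ← hf.coe_toReal_fn hz.2] at h
  exact_mod_cast h

theorem NumeratorAssumption.mem_of_isMinOn (hf : NumeratorAssumption S f fs fn ℓ)
    {τ θ : ℝ} {w u v y : H} (hy : y ∈ S)
    (hmin : IsMinOn (subproblem fs fn ℓ τ θ w u v) S y) {z : H} (hz : z ∈ S ∩ dom f) :
    y ∈ S ∩ dom f := by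
  refine ⟨hy, hf.mem_dom_iff.2 ?_⟩
  have h := hmin hz.1
  simp only [mem_ofPred_eq, subproblem] at h
  by_contra hc
  rw [not_lt_top_iff.1 hc, EReal.top_add_of_ne_bot (EReal.coe_ne_bot _)] at h
  exact absurd (h.trans_lt (EReal.add_lt_top (hf.mem_dom_iff.1 hz.2).ne (EReal.coe_ne_top _)))
    (lt_irrefl _)

/-- The decrease of the objective in one step of the algorithm. -/
theorem mul_theta_sub_le (hf : NumeratorAssumption S f fs fn ℓ)
    (hg : DenominatorAssumption S g β) {x y w d : H} {τ κ μ : ℝ} (hτ : 0 < τ)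
    (hμ : 0 ≤ μ) (hx : x ∈ S ∩ dom f) (hy : y ∈ S ∩ dom f)
    (hw : inner ℝ w (y - x) ≤ (g y).toReal - (g x).toReal + β / 2 * ‖y - x‖ ^ 2)
    (hmin : IsMinOn (subproblem fs fn ℓ τ (theta f g x) w (x + κ • d) (x + μ • d)) S y) :
    (g y).toReal * (theta f g y - theta f g x) ≤ ℓ / 2 * κ ^ 2 * ‖d‖ ^ 2
      + μ / τ * (‖d‖ * ‖y - x‖) - (1 / τ - β * theta f g x) / 2 * ‖y - x‖ ^ 2 := by
  have hmin' := hf.le_of_isMinOn hy hmin hx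
  have hθ := theta_nonneg hf hg hx
  set θ := theta f g x with hθdef
  have hdiff : Differentiable ℝ fs := hf.smooth.differentiable one_ne_zero
  set u := x + κ • d with hu
  -- `fs` is bounded above at `y` and below at `x`, both from its linearization at `u`. The term
  -- `ℓ/2‖y - u‖²` cancels against the model, leaving `ℓ/2‖x - u‖² = ℓ/2 κ²‖d‖²`.
  have hdesc := le_add_inner_gradient_add_sq hdiff hf.lipschitz u y
  have hconv := add_fderiv_le_of_convexOn hf.convex (mem_univ u) (mem_univ x)
    (hdiff u).hasGradientAt.hasFDerivAt
  rw [InnerProductSpace.toDual_apply_apply] at hconv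
  have hxu : ‖x - u‖ ^ 2 = κ ^ 2 * ‖d‖ ^ 2 := by
    rw [hu, sub_add_cancel_left, norm_neg, norm_smul, mul_pow, Real.norm_eq_abs, sq_abs]
  have hGy := hg.toReal_pos hy.1
  have hGx := hg.toReal_pos hx.1
  have hFy : (f y).toReal = theta f g y * (g y).toReal := by
    rw [theta_eq f g hf hg hy, div_mul_cancel₀ _ hGy.ne']
  have hFx : (f x).toReal = θ * (g x).toReal := by
    rw [hθdef, theta_eq f g hf hg hx, div_mul_cancel₀ _ hGx.ne']
  rw [hf.toReal_eq hy.2] at hFy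
  rw [hf.toReal_eq hx.2] at hFx
  -- The shift `τθw` of the proximal centre produces `θ⟨w, y - x⟩`, which `hw` bounds through `θ(g y
  -- - g x)`. Since `f x = θ g x`, the difference `f y - f x - θ(g y - g x)` is `g y` times the
  -- change of the ratio.
  have hquad : 1 / (2 * τ) * (‖x - (x + μ • d) - (τ * θ) • w‖ ^ 2
      - ‖y - (x + μ • d) - (τ * θ) • w‖ ^ 2)
      = μ / τ * inner ℝ d (y - x) + θ * inner ℝ w (y - x) - 1 / τ / 2 * ‖y - x‖ ^ 2 := by
    set p := μ • d + (τ * θ) • w with hp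
    have e1 : x - (x + μ • d) - (τ * θ) • w = -p := by rw [hp]; abel
    have e2 : y - (x + μ • d) - (τ * θ) • w = (y - x) - p := by rw [hp]; abel
    have e3 : inner ℝ (y - x) p = μ * inner ℝ d (y - x) + τ * θ * inner ℝ w (y - x) := by
      rw [real_inner_comm, hp, inner_add_left, real_inner_smul_left, real_inner_smul_left]
    rw [e1, e2, norm_neg, norm_sub_sq_real, e3]
    field_simp
    ring
  have hinner : μ / τ * inner ℝ d (y - x) ≤ μ / τ * (‖d‖ * ‖y - x‖) :=
    mul_le_mul_of_nonneg_left (real_inner_le_norm _ _) (by positivity)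
  have hθw := mul_le_mul_of_nonneg_left hw hθ
  simp only [smoothModel] at hmin'
  rw [hxu] at hmin'
  nlinarith

/-- The Fréchet subgradient of the objective at the new iterate. -/
def stepSubgradient (fs : H → ℝ) (ℓ τ θ θ' G : ℝ) (w w' u v y : H) : H :=
  G⁻¹ • (gradient fs y - (gradient fs u + (1 / τ) • (y - v - (τ * θ) • w) + ℓ • (y - u))
    - θ' • w')

/-- Minimality says `fn z ≥ fn y + model y - model z` on the feasible set. Adding `fs z` and
dividing by `g z > 0` gives `R`, with equality at `y`; elsewhere the ratio is `⊤`. -/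
theorem exists_minorant_of_isMinOn (hf : NumeratorAssumption S f fs fn ℓ)
    (hg : DenominatorAssumption S g β) {τ θ : ℝ} {w u v y w' : H} (hy : y ∈ S ∩ dom f)
    (hmin : IsMinOn (subproblem fs fn ℓ τ θ w u v) S y)
    (hw' : HasFDerivAt (fun p => (g p).toReal) (innerSL ℝ w') y) :
    ∃ R : H → ℝ, ratioFn S f g y = (R y : EReal) ∧
      (∀ᶠ z in 𝓝 y, (R z : EReal) ≤ ratioFn S f g z) ∧
      HasFDerivAt R (innerSL ℝ
        (stepSubgradient fs ℓ τ θ (theta f g y) (g y).toReal w w' u v y)) y := by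
  have hGy := hg.toReal_pos hy.1
  have hdiff : Differentiable ℝ fs := hf.smooth.differentiable one_ne_zero
  refine ⟨fun z => ((fn y).toReal + smoothModel fs ℓ τ θ w u v y
    + (fs z - smoothModel fs ℓ τ θ w u v z)) * ((g z).toReal)⁻¹, ?_, ?_, ?_⟩
  · rw [ratioFn_of_mem hf hg hy, theta_eq f g hf hg hy, hf.toReal_eq hy.2, div_eq_mul_inv]
    congr 2
    ring
  · refine Eventually.of_forall fun z => ?_
    by_cases hz : z ∈ S ∩ dom f
    · rw [ratioFn_of_mem hf hg hz, theta_eq f g hf hg hz, hf.toReal_eq hz.2, div_eq_mul_inv,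
        EReal.coe_le_coe_iff]
      refine mul_le_mul_of_nonneg_right ?_ (inv_nonneg.2 (hg.toReal_pos hz.1).le)
      have := hf.le_of_isMinOn hy hmin hz
      linarith
    · rw [ratioFn_of_notMem hg hz]
      exact le_top
  · have h1 : HasFDerivAt fs (innerSL ℝ (gradient fs y)) y :=
      (hdiff y).hasGradientAt.hasFDerivAt
    have h2 := ((h1.sub (hasFDerivAt_smoothModel fs ℓ τ θ w u v y)).const_add
      ((fn y).toReal + smoothModel fs ℓ τ θ w u v y)).mul
      ((hasDerivAt_inv hGy.ne').comp_hasFDerivAt y hw')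
    refine HasFDerivAt.congr_fderiv (f := fun z => ((fn y).toReal + smoothModel fs ℓ τ θ w u v y
      + (fs z - smoothModel fs ℓ τ θ w u v z)) * ((g z).toReal)⁻¹) h2 ?_
    rw [theta_eq f g hf hg hy, hf.toReal_eq hy.2, stepSubgradient]
    ext p
    simp only [add_apply, smul_apply, map_smul, map_sub, sub_apply,
      smul_eq_mul, Pi.sub_apply, Function.comp_apply]
    field_simp
    ring

/-- The proximal shift contributes `θw`, and `θw - θ'w' = θ(w - w') + (θ - θ')w'`. Every term is
then small when consecutive iterates are close. -/
theorem norm_stepSubgradient_le (hlip : ∀ x y, ‖gradient fs x - gradient fs y‖ ≤ ℓ * ‖x - y‖)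
    (hℓ : 0 ≤ ℓ) {τ θ θ' G m : ℝ} (hτ : 0 < τ) (hm : 0 < m) (hG : m ≤ G) (hθ : 0 ≤ θ)
    (w w' u v y : H) :
    ‖stepSubgradient fs ℓ τ θ θ' G w w' u v y‖ ≤ m⁻¹ * (2 * ℓ * ‖y - u‖ + 1 / τ * ‖y - v‖
      + θ * ‖w - w'‖ + |θ - θ'| * ‖w'‖) := by
  have hG0 : 0 < G := hm.trans_le hG
  rw [stepSubgradient, norm_smul, Real.norm_of_nonneg (inv_nonneg.2 hG0.le)]
  refine mul_le_mul (inv_anti₀ hm hG) ?_ (norm_nonneg _) (inv_nonneg.2 hm.le)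
  have e : gradient fs y - (gradient fs u + (1 / τ) • (y - v - (τ * θ) • w) + ℓ • (y - u))
      - θ' • w' = (gradient fs y - gradient fs u) - ℓ • (y - u) - (1 / τ) • (y - v)
        + θ • (w - w') + (θ - θ') • w' := by
    have : (1 / τ) • (τ * θ) • w = θ • w := by
      rw [smul_smul]; congr 1; field_simp
    rw [smul_sub (1 / τ) (y - v), this]
    module
  rw [e]
  have h1 : ‖ℓ • (y - u)‖ = ℓ * ‖y - u‖ := by rw [norm_smul, Real.norm_of_nonneg hℓ]
  have h2 : ‖(1 / τ) • (y - v)‖ = 1 / τ * ‖y - v‖ := by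
    rw [norm_smul, Real.norm_of_nonneg (by positivity)]
  have h3 : ‖θ • (w - w')‖ = θ * ‖w - w'‖ := by rw [norm_smul, Real.norm_of_nonneg hθ]
  have h4 : ‖(θ - θ') • w'‖ = |θ - θ'| * ‖w'‖ := by rw [norm_smul, Real.norm_eq_abs]
  have h5 := norm_add_le ((gradient fs y - gradient fs u) - ℓ • (y - u) - (1 / τ) • (y - v)
        + θ • (w - w')) ((θ - θ') • w')
  have h6 := norm_add_le ((gradient fs y - gradient fs u) - ℓ • (y - u) - (1 / τ) • (y - v))
    (θ • (w - w'))
  have h7 := norm_sub_le ((gradient fs y - gradient fs u) - ℓ • (y - u)) ((1 / τ) • (y - v))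
  have h8 := norm_sub_le (gradient fs y - gradient fs u) (ℓ • (y - u))
  have h9 := hlip y u
  linarith

/-- Local bounds for the objective and for the gradient of the denominator. -/
theorem exists_local_bounds (hf : NumeratorAssumption S f fs fn ℓ)
    (hg : DenominatorAssumption S g β) (hfn : NonsmoothAssumption S f fn g fl C)
    {U : Set H} (hU : IsOpen U) (hDU : S ∩ dom f ⊆ U) (hgU : ContDiffFnOn U g)
    {ε ℓg : ℝ} (hε : 0 < ε) (hℓg : 0 < ℓg)
    (hgLip : ∀ y ∈ S ∩ dom f, ∀ z ∈ S ∩ dom f, ‖y - z‖ ≤ ε →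
      ‖gradient (fun p => (g p).toReal) y - gradient (fun p => (g p).toReal) z‖ ≤ ℓg * ‖y - z‖)
    {a : H} (ha : a ∈ S ∩ dom f) :
    ∃ m > (0 : ℝ), ∃ K ≥ (0 : ℝ), ∃ r > (0 : ℝ),
      (∀ y ∈ S ∩ dom f, dist y a < r → m ≤ (g y).toReal ∧ theta f g y ≤ K ∧
        ‖gradient (fun p => (g p).toReal) y‖ ≤ K) ∧
      ∀ y ∈ S ∩ dom f, ∀ z ∈ S ∩ dom f, dist y a < r → dist z a < r →
        |theta f g y - theta f g z| ≤ K * ‖y - z‖ ∧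
        ‖gradient (fun p => (g p).toReal) y - gradient (fun p => (g p).toReal) z‖
          ≤ K * ‖y - z‖ := by
  set G : H → ℝ := fun p => (g p).toReal with hGdef
  obtain ⟨K₁, hK₁, V, hV, hFlip⟩ := hfn.exists_lipschitz hf ha
  have hcd : ContDiffAt ℝ 1 G a := hgU.2.contDiffAt (hU.mem_nhds (hDU ha))
  obtain ⟨K₂, W, hW, hGlip⟩ := hcd.exists_lipschitzOnWith
  have hGa : 0 < G a := hg.toReal_pos ha.1
  have hpos : ∀ᶠ y in 𝓝 a, G a / 2 < G y :=
    hcd.continuousAt.eventually (lt_mem_nhds (half_lt_self hGa))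
  obtain ⟨r₀, hr₀, hball⟩ := Metric.eventually_nhds_iff.1
    ((hpos.and (eventually_mem_set.2 hV)).and (eventually_mem_set.2 hW))
  set m := G a / 2 with hm
  have hm0 : 0 < m := half_pos hGa
  set T := ((f a).toReal + K₁) / m with hT
  have hT0 : 0 ≤ T := div_nonneg (add_nonneg (hf.toReal_nonneg ha) hK₁) hm0.le
  -- Radius `ε / 2` puts any two points of the ball within `ε`, so that `hgLip` applies; radius `1`
  -- gives `f y ≤ f a + K₁`, hence the bound `T` on the ratio.
  set r := min r₀ (min (ε / 2) 1) with hr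
  have hr0 : 0 < r := lt_min hr₀ (lt_min (half_pos hε) one_pos)
  have hone : ∀ y ∈ S ∩ dom f, dist y a < r → m ≤ G y ∧ theta f g y ≤ T ∧
      ‖gradient G y‖ ≤ ‖gradient G a‖ + ℓg * ε := by
    intro y hy hya
    obtain ⟨⟨h1, h2⟩, -⟩ := hball (hya.trans_le (min_le_left _ _))
    have h3 : ‖y - a‖ < ε / 2 := by
      rw [← dist_eq_norm]
      exact hya.trans_le ((min_le_right _ _).trans (min_le_left _ _))
    have h4 : ‖y - a‖ < 1 := by
      rw [← dist_eq_norm]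
      exact hya.trans_le ((min_le_right _ _).trans (min_le_right _ _))
    refine ⟨h1.le, ?_, ?_⟩
    · rw [theta_eq f g hf hg hy, hT]
      refine div_le_div₀ (add_nonneg (hf.toReal_nonneg ha) hK₁) ?_ hm0 h1.le
      have h5 := (le_abs_self _).trans (hFlip y ⟨h2, hy⟩ a ⟨mem_of_mem_nhds hV, ha⟩)
      have h6 : K₁ * ‖y - a‖ ≤ K₁ * 1 := mul_le_mul_of_nonneg_left h4.le hK₁
      linarith
    · have h5 := hgLip y hy a ha (by linarith)
      have h6 := norm_sub_norm_le (gradient G y) (gradient G a)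
      have h7 : ℓg * ‖y - a‖ ≤ ℓg * ε := mul_le_mul_of_nonneg_left (by linarith) hℓg.le
      linarith
  -- Lipschitz constant of the ratio, from `(θ_y - θ_z) g y = (f y - f z) - θ_z (g y - g z)`.
  set A := (K₁ + T * K₂) / m with hA
  have hA0 : 0 ≤ A := by positivity
  set B := ‖gradient G a‖ + ℓg * ε with hB
  have hB0 : 0 ≤ B := by positivity
  refine ⟨m, hm0, T + B + A + ℓg, by positivity, r, hr0, fun y hy hya => ?_,
    fun y hy z hz hya hza => ?_⟩
  · obtain ⟨h1, h2, h3⟩ := hone y hy hya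
    exact ⟨h1, by linarith, h3.trans (by linarith)⟩
  · have hGy := hg.toReal_pos hy.1
    have hGz := hg.toReal_pos hz.1
    obtain ⟨hmy, -, -⟩ := hone y hy hya
    obtain ⟨-, hTz, -⟩ := hone z hz hza
    obtain ⟨⟨-, hyV⟩, hyW⟩ := hball (hya.trans_le (min_le_left _ _))
    obtain ⟨⟨-, hzV⟩, hzW⟩ := hball (hza.trans_le (min_le_left _ _))
    have hθz := theta_nonneg hf hg hz
    have hnn := norm_nonneg (y - z)
    constructor
    · have h1 := hFlip y ⟨hyV, hy⟩ z ⟨hzV, hz⟩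
      have h2 : |G y - G z| ≤ K₂ * ‖y - z‖ := by
        have := hGlip.dist_le_mul y hyW z hzW
        rwa [Real.dist_eq, dist_eq_norm] at this
      have h3 : (theta f g y - theta f g z) * G y
          = ((f y).toReal - (f z).toReal) - theta f g z * (G y - G z) := by
        rw [theta_eq f g hf hg hy, theta_eq f g hf hg hz, hGdef]
        field_simp
        ring
      have h4 : |theta f g y - theta f g z| * G y ≤ (K₁ + T * K₂) * ‖y - z‖ := by
        rw [← abs_of_pos (show 0 < G y from hGy), ← abs_mul, h3]
        refine (abs_sub _ _).trans ?_
        rw [abs_mul, abs_of_nonneg hθz]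
        have h5 : theta f g z * |G y - G z| ≤ T * (K₂ * ‖y - z‖) :=
          mul_le_mul hTz h2 (abs_nonneg _) hT0
        linarith
      have h5 : |theta f g y - theta f g z| * m ≤ (K₁ + T * K₂) * ‖y - z‖ :=
        (mul_le_mul_of_nonneg_left hmy (abs_nonneg _)).trans h4
      have h6 : |theta f g y - theta f g z| ≤ A * ‖y - z‖ := by
        rw [hA, div_mul_eq_mul_div, le_div_iff₀ hm0]
        exact h5
      refine h6.trans (mul_le_mul_of_nonneg_right (by linarith) hnn)
    · have h1 : ‖y - z‖ ≤ ε := by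
        have h2 := dist_triangle_right y z a
        have h3 : r ≤ ε / 2 := (min_le_right _ _).trans (min_le_left _ _)
        rw [← dist_eq_norm]
        linarith
      refine (hgLip y hy z hz h1).trans (mul_le_mul_of_nonneg_right (by linarith) hnn)

end Step

/-! ### Sufficient decrease, relative error and cluster points of the iterates. -/

section Algorithm

variable {H : Type*} [NormedAddCommGroup H] [InnerProductSpace ℝ H] [CompleteSpace H]
  {S : Set H} {f : H → EReal} {fs : H → ℝ} {fn g fl : H → EReal} {C : Set H}
  {ℓ β δ ζ μbar κbar c : ℝ} {x w : ℕ → H} {τ κ μ : ℕ → ℝ}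

theorem IsIterates.feasible (hx : IsIterates S f fs fn g ℓ β δ ζ μbar κbar x w τ κ μ)
    (hf : NumeratorAssumption S f fs fn ℓ) (n : ℕ) : x n ∈ S ∩ dom f := by
  induction n with
  | zero => exact hx.init
  | succ n ih => exact hf.mem_of_isMinOn (hx.mem n) (hx.argmin n) ih

theorem IsIterates.eq_gradient (hx : IsIterates S f fs fn g ℓ β δ ζ μbar κbar x w τ κ μ)
    (hf : NumeratorAssumption S f fs fn ℓ) {U : Set H} (hU : IsOpen U) (hDU : S ∩ dom f ⊆ U)
    (hgU : ContDiffFnOn U g) (n : ℕ) : w n = gradient (fun p => (g p).toReal) (x n) :=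
  hgU.eq_gradient hU (hDU (hx.feasible hf n)) (hx.subgrad n)

theorem IsIterates.le_one_div_tau (hx : IsIterates S f fs fn g ℓ β δ ζ μbar κbar x w τ κ μ)
    (hδ : 0 < δ) (n : ℕ) : max (√β * theta f g (x n) / ζ) δ ≤ 1 / τ n := by
  have h0 : 0 < max (√β * theta f g (x n) / ζ) δ := lt_max_of_lt_right hδ
  rw [le_div_iff₀ (hx.τ_pos n), ← le_div_iff₀' h0]
  exact hx.τ_le n

/-- The decrease of the objective along the iterates. -/
theorem IsIterates.mul_theta_sub_le
    (hx : IsIterates S f fs fn g ℓ β δ ζ μbar κbar x w τ κ μ)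
    (hf : NumeratorAssumption S f fs fn ℓ) (hg : DenominatorAssumption S g β)
    (hS : Convex ℝ S) {U : Set H} (hU : IsOpen U) (hDU : S ∩ dom f ⊆ U)
    (hgU : ContDiffFnOn U g) (hδ : 0 < δ) (hζ : 0 < ζ) (hζ' : 0 < 1 - √β * ζ) (n : ℕ) :
    (g (x (n + 1))).toReal * (theta f g (x (n + 1)) - theta f g (x n))
      ≤ ℓ / 2 * κbar ^ 2 * ‖x n - x (n - 1)‖ ^ 2
      + μbar * (‖x n - x (n - 1)‖ * ‖x (n + 1) - x n‖)
      - δ * (1 - √β * ζ) / 2 * ‖x (n + 1) - x n‖ ^ 2 := by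
  have hn := hx.feasible hf n
  have hn1 := hx.feasible hf (n + 1)
  have hw := hx.eq_gradient hf hU hDU hgU n
  have hτ := hx.τ_pos n
  have hθ := theta_nonneg hf hg hn
  have h1 := EPSG.mul_theta_sub_le hf hg hτ (hx.μ_mem n).1 hn hn1
    (hg.inner_le hS hn.1 hn1.1 (hw ▸ hgU.hasFDerivAt hU (hDU hn))) (hx.argmin n)
  have hκ : κ n ^ 2 ≤ κbar ^ 2 := pow_le_pow_left₀ (hx.κ_mem n).1 (hx.κ_mem n).2 2
  have hμ : μ n / τ n ≤ μbar := (div_le_iff₀ hτ).2 (hx.μ_mem n).2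
  have hmax := hx.le_one_div_tau hδ n
  have hβ : √β * √β = β := Real.mul_self_sqrt hg.modulus_nonneg
  have hs0 := Real.sqrt_nonneg β
  -- The step-size rule gives `βθ ≤ √β ζ / τ` and `1 / τ ≥ δ`.
  have hco : δ * (1 - √β * ζ) ≤ 1 / τ n - β * theta f g (x n) := by
    have h2 := (le_max_left _ _).trans hmax
    have h3 := (le_max_right _ _).trans hmax
    rw [div_le_iff₀ hζ] at h2
    have h4 := mul_le_mul_of_nonneg_left h2 hs0
    have h5 := mul_le_mul_of_nonneg_right h3 hζ'.le
    rw [← mul_assoc, hβ] at h4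
    linarith
  have h2 : ℓ / 2 * κ n ^ 2 * ‖x n - x (n - 1)‖ ^ 2
      ≤ ℓ / 2 * κbar ^ 2 * ‖x n - x (n - 1)‖ ^ 2 := by
    have := hf.modulus_nonneg
    gcongr
  have h3 : μ n / τ n * (‖x n - x (n - 1)‖ * ‖x (n + 1) - x n‖)
      ≤ μbar * (‖x n - x (n - 1)‖ * ‖x (n + 1) - x n‖) := by gcongr
  have h4 : δ * (1 - √β * ζ) / 2 * ‖x (n + 1) - x n‖ ^ 2
      ≤ (1 / τ n - β * theta f g (x n)) / 2 * ‖x (n + 1) - x n‖ ^ 2 := by gcongr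
  linarith

/-- Young's inequality `2√(mM) D'D ≤ mD'² + MD²` turns the right side of `h` into `m A D'² - M B D²`
with `A, B ≥ 0`. Replacing both `m` and `M` by `G` only increases it, and `G` can be divided out. -/
theorem extrapolation_step_le {m M G δ' ℓ κbar μbar t D D' : ℝ} (hm : 0 < m) (hM : 0 < M)
    (hmG : m ≤ G) (hGM : G ≤ M) (hℓ : 0 ≤ ℓ) (hμ : 0 ≤ μbar)
    (ha : 0 ≤ δ' / (2 * M) - μbar / (2 * √(m * M)))
    (h : G * t ≤ ℓ / 2 * κbar ^ 2 * D' ^ 2 + μbar * (D' * D) - δ' / 2 * D ^ 2) :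
    t ≤ (ℓ * κbar ^ 2 / (2 * m) + μbar / (2 * √(m * M))) * D' ^ 2
      - (δ' / (2 * M) - μbar / (2 * √(m * M))) * D ^ 2 := by
  have hs : 0 < √(m * M) := Real.sqrt_pos.2 (by positivity)
  have hs2 : √(m * M) ^ 2 = m * M := Real.sq_sqrt (by positivity)
  set s := √(m * M) with hsdef
  have hG : 0 < G := hm.trans_le hmG
  have hyoung : D' * D ≤ (m * D' ^ 2 + M * D ^ 2) / (2 * s) := by
    rw [le_div_iff₀ (by positivity)]
    have h1 : 0 ≤ m * (m * D' ^ 2 + M * D ^ 2 - D' * D * (2 * s)) := by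
      have : m * (m * D' ^ 2 + M * D ^ 2 - D' * D * (2 * s)) = (m * D' - s * D) ^ 2 := by
        linear_combination -(D ^ 2) * hs2
      rw [this]; positivity
    have := nonneg_of_mul_nonneg_right h1 hm
    linarith
  have h1 := mul_le_mul_of_nonneg_left hyoung hμ
  set A := ℓ * κbar ^ 2 / (2 * m) + μbar / (2 * s) with hA
  set B := δ' / (2 * M) - μbar / (2 * s) with hB
  have hA0 : 0 ≤ A := by positivity
  have h2 : ℓ / 2 * κbar ^ 2 * D' ^ 2 + μbar * ((m * D' ^ 2 + M * D ^ 2) / (2 * s))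
      - δ' / 2 * D ^ 2 = m * (A * D' ^ 2) - M * (B * D ^ 2) := by
    rw [hA, hB]; field_simp; ring
  have h3 : m * (A * D' ^ 2) ≤ G * (A * D' ^ 2) := by gcongr
  have h4 : G * (B * D ^ 2) ≤ M * (B * D ^ 2) := by gcongr
  have h5 : G * t ≤ G * (A * D' ^ 2 - B * D ^ 2) := by linarith
  exact le_of_mul_le_mul_left h5 hG

theorem AdmissibleParams.nonneg {X : Type*} {S : Set X} {f g : X → EReal}
    (hp : AdmissibleParams S f g ℓ β δ ζ μbar κbar c)
    (hℓ : 0 ≤ ℓ) : 0 ≤ c ∧ 0 ≤ μbar ∧ 0 ≤ κbar := by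
  rcases hp.bounds with ⟨m, M, ⟨hm, hM, -⟩, ⟨hμ, -⟩, ⟨hκ, -⟩, rfl⟩ | ⟨-, rfl, rfl, rfl⟩
  · exact ⟨by positivity, hμ, hκ⟩
  · simp

/-- This margin is the coefficient of the decrease minus `c`. If `ℓ > 0` it is `ℓ / (2m)` times the
gap between `κbar²` and its squared bound; if `ℓ = 0` the bound on `μbar` decides. -/
theorem extrapolation_margin_pos {m M δ' ℓ κbar μbar : ℝ} (hm : 0 < m) (hM : 0 < M)
    (hℓ : 0 ≤ ℓ) (hμ : μbar < δ' * √(m * M) / (2 * M)) (hκ0 : 0 ≤ κbar)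
    (hκ : 0 < ℓ → κbar < √(m * δ' / (ℓ * M) - 2 * m * μbar / (ℓ * √(m * M)))) :
    0 < δ' / (2 * M) - μbar / (2 * √(m * M))
      - (ℓ * κbar ^ 2 / (2 * m) + μbar / (2 * √(m * M))) := by
  have hs : 0 < √(m * M) := Real.sqrt_pos.2 (by positivity)
  set s := √(m * M) with hsdef
  rcases hℓ.eq_or_lt with rfl | hℓ
  · rw [lt_div_iff₀ (by positivity)] at hμ
    have : δ' / (2 * M) - μbar / (2 * s) - (0 * κbar ^ 2 / (2 * m) + μbar / (2 * s))
        = (δ' * s - μbar * (2 * M)) / (2 * M * s) := by field_simp; ring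
    rw [this]
    exact div_pos (by linarith) (by positivity)
  · have h1 := (Real.lt_sqrt hκ0).1 (hκ hℓ)
    have h2 : δ' / (2 * M) - μbar / (2 * s) - (ℓ * κbar ^ 2 / (2 * m) + μbar / (2 * s))
        = ℓ / (2 * m) * (m * δ' / (ℓ * M) - 2 * m * μbar / (ℓ * s) - κbar ^ 2) := by
      field_simp
      ring
    rw [h2]
    exact mul_pos (by positivity) (sub_pos.2 h1)

/-- The value of the merit function along the iterates. -/
def meritSeq (f g : H → EReal) (c : ℝ) (x : ℕ → H) (n : ℕ) : ℝ :=
  theta f g (x n) + c * ‖x n - x (n - 1)‖ ^ 2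

theorem mem_levelSet (hf : NumeratorAssumption S f fs fn ℓ) (hg : DenominatorAssumption S g β)
    {y z : H} (hy : y ∈ S ∩ dom f) (hz : z ∈ S ∩ dom f) (h : theta f g y ≤ theta f g z) :
    y ∈ {y ∈ S | f y / g y ≤ f z / g z} := by
  refine ⟨hy.1, ?_⟩
  rw [div_eq_coe_theta hf hg hy, div_eq_coe_theta hf hg hz]
  exact_mod_cast h

/-- The merit function decreases sufficiently along the iterates. -/
theorem IsIterates.exists_sufficient_decrease [ProperSpace H]
    (hx : IsIterates S f fs fn g ℓ β δ ζ μbar κbar x w τ κ μ)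
    (hf : NumeratorAssumption S f fs fn ℓ) (hg : DenominatorAssumption S g β)
    (hp : AdmissibleParams S f g ℓ β δ ζ μbar κbar c)
    (hS : Convex ℝ S) (hSc : IsClosed S) {U : Set H} (hU : IsOpen U) (hDU : S ∩ dom f ⊆ U)
    (hgU : ContDiffFnOn U g)
    (hbdd : Bornology.IsBounded {y ∈ S | f y / g y ≤ f (x 0) / g (x 0)}) :
    ∃ a > (0 : ℝ), ∀ n, meritSeq f g c x (n + 1) + a * ‖x (n + 1) - x n‖ ^ 2
      ≤ meritSeq f g c x n := by
  have hstep := hx.mul_theta_sub_le hf hg hS hU hDU hgU hp.δ_pos hp.ζ_pos hp.ζ_lt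
  have hδ' : 0 < δ * (1 - √β * ζ) := mul_pos hp.δ_pos hp.ζ_lt
  have hD := hx.feasible hf
  have hGpos := fun n => hg.toReal_pos (hD n).1
  simp only [meritSeq, Nat.add_sub_cancel]
  rcases hp.bounds with ⟨m, M, ⟨hm, hM, hmM⟩, ⟨hμ0, hμ⟩, ⟨hκ0, hκ⟩, hc⟩ | ⟨-, hμ, hκ, hc⟩
  · have hκ' : 0 < ℓ → κbar < √(m * (δ * (1 - √β * ζ)) / (ℓ * M)
        - 2 * m * μbar / (ℓ * √(m * M))) := by simpa only [mul_assoc] using hκ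
    have ha := extrapolation_margin_pos hm hM hf.modulus_nonneg hμ hκ0 hκ'
    rw [← hc] at ha
    refine ⟨_, ha, fun n => ?_⟩
    have hb := hmM _ (hD (n + 1))
    rw [← hg.coe_toReal (hD (n + 1)).1, EReal.coe_le_coe_iff, EReal.coe_le_coe_iff] at hb
    have h1 := extrapolation_step_le hm hM hb.1 hb.2 hf.modulus_nonneg hμ0
      (by linarith [(hp.nonneg hf.modulus_nonneg).1]) (hstep n)
    rw [← hc] at h1
    linarith
  -- Without extrapolation the ratio itself decreases, so the iterates stay in the bounded sublevel
  -- set, where `g` has an upper bound.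
  · subst hμ hκ hc
    have hmono : ∀ n, theta f g (x (n + 1)) ≤ theta f g (x n) := by
      intro n
      have h1 := hstep n
      have h2 : (g (x (n + 1))).toReal * (theta f g (x (n + 1)) - theta f g (x n)) ≤ 0 := by
        have : 0 ≤ δ * (1 - √β * ζ) / 2 * ‖x (n + 1) - x n‖ ^ 2 := by positivity
        linarith
      linarith [nonpos_of_mul_nonpos_right h2 (hGpos (n + 1))]
    obtain ⟨M, hM, hMb⟩ := exists_bound_of_isBounded hg hSc hbdd (fun y hy => hy.1)
    refine ⟨δ * (1 - √β * ζ) / 2 / M, by positivity, fun n => ?_⟩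
    have h1 := hstep n
    have h2 := hMb _ (mem_levelSet hf hg (hD (n + 1)) hx.init
      (antitone_nat_of_succ_le (f := fun k => theta f g (x k)) hmono (Nat.zero_le (n + 1))))
    set P := δ * (1 - √β * ζ) / 2 * ‖x (n + 1) - x n‖ ^ 2 with hP
    have hP0 : 0 ≤ P := by positivity
    have h3 : (g (x (n + 1))).toReal * (P / M) ≤ P := by
      rw [mul_div_assoc', div_le_iff₀ hM, mul_comm P]
      exact mul_le_mul_of_nonneg_right h2 hP0
    have h4 : (g (x (n + 1))).toReal * (theta f g (x (n + 1)) - theta f g (x n) + P / M) ≤ 0 := by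
      linarith
    have h5 := nonpos_of_mul_nonpos_right h4 (hGpos (n + 1))
    have h6 : δ * (1 - √β * ζ) / 2 / M * ‖x (n + 1) - x n‖ ^ 2 = P / M := by rw [hP]; ring
    rw [h6]
    linarith

/-- Around a feasible point, the distance of `0` to the subdifferentials of the objective and of
the merit function at the iterates is controlled by the last two steps. -/
theorem IsIterates.exists_subgradient_bound
    (hx : IsIterates S f fs fn g ℓ β δ ζ μbar κbar x w τ κ μ)
    (hf : NumeratorAssumption S f fs fn ℓ) (hg : DenominatorAssumption S g β)
    (hfn : NonsmoothAssumption S f fn g fl C)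
    (hp : AdmissibleParams S f g ℓ β δ ζ μbar κbar c)
    (hτ : 0 < liminf τ atTop)
    {U : Set H} (hU : IsOpen U) (hDU : S ∩ dom f ⊆ U) (hgU : ContDiffFnOn U g)
    {ε ℓg : ℝ} (hε : 0 < ε) (hℓg : 0 < ℓg)
    (hgLip : ∀ y ∈ S ∩ dom f, ∀ z ∈ S ∩ dom f, ‖y - z‖ ≤ ε →
      ‖gradient (fun p => (g p).toReal) y - gradient (fun p => (g p).toReal) z‖ ≤ ℓg * ‖y - z‖)
    {a : H} (ha : a ∈ S ∩ dom f) :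
    ∃ b > (0 : ℝ), ∃ r > (0 : ℝ), ∃ N : ℕ, ∀ n ≥ N, dist (x n) a < r → dist (x (n + 1)) a < r →
      (∃ q ∈ frechetSubdiff (ratioFn S f g) (x (n + 1)),
        ‖q‖ ≤ b * (‖x (n + 1) - x n‖ + ‖x n - x (n - 1)‖)) ∧
      ∃ p ∈ frechetSubdiff (meritFn S f g c) (WithLp.toLp 2 (x (n + 1), x n)),
        ‖p‖ ≤ b * (‖x (n + 1) - x n‖ + ‖x n - x (n - 1)‖) := by
  obtain ⟨m, hm, K, hK, r, hr, hone, htwo⟩ :=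
    exists_local_bounds hf hg hfn hU hDU hgU hε hℓg hgLip ha
  obtain ⟨hc, hμ0, hκ0⟩ := hp.nonneg hf.modulus_nonneg
  have hℓ := hf.modulus_nonneg
  obtain ⟨t, ht, htlim⟩ := exists_between hτ
  have hbd : IsBoundedUnder (· ≥ ·) atTop τ := isBoundedUnder_of ⟨0, fun n => (hx.τ_pos n).le⟩
  obtain ⟨N, hN⟩ := eventually_atTop.1 (eventually_lt_of_lt_liminf htlim hbd)
  -- The summands match the four terms of `norm_stepSubgradient_le`; `t` is an eventual lower bound
  -- of the step sizes.
  set B := m⁻¹ * (2 * ℓ * (1 + κbar) + (1 / t + μbar) + K * K + K * K) with hB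
  have hB0 : 0 ≤ B := by positivity
  refine ⟨B + 4 * c + 1, by positivity, r, hr, N, fun n hn hxn hxn1 => ?_⟩
  have hDn := hx.feasible hf n
  have hDn1 := hx.feasible hf (n + 1)
  have hτn := hx.τ_pos n
  have hθn := theta_nonneg hf hg hDn
  have hw := hx.eq_gradient hf hU hDU hgU n
  obtain ⟨R, hR1, hR2, hR3⟩ := exists_minorant_of_isMinOn hf hg hDn1 (hx.argmin n)
    (hgU.hasFDerivAt hU (hDU hDn1))
  set q := stepSubgradient fs ℓ (τ n) (theta f g (x n)) (theta f g (x (n + 1)))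
    (g (x (n + 1))).toReal (w n) (gradient (fun p => (g p).toReal) (x (n + 1)))
    (x n + κ n • (x n - x (n - 1))) (x n + μ n • (x n - x (n - 1))) (x (n + 1)) with hq
  set D := ‖x (n + 1) - x n‖ with hD
  set D' := ‖x n - x (n - 1)‖ with hD'
  have hD0 : 0 ≤ D := norm_nonneg _
  have hD'0 : 0 ≤ D' := norm_nonneg _
  obtain ⟨-, hθK, -⟩ := hone _ hDn hxn
  obtain ⟨hmG, -, hwK⟩ := hone _ hDn1 hxn1
  obtain ⟨hθθ, hww⟩ := htwo _ hDn _ hDn1 hxn hxn1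
  rw [norm_sub_rev (x n)] at hθθ hww
  have hqB : ‖q‖ ≤ B * (D + D') := by
    refine (norm_stepSubgradient_le hf.lipschitz hℓ hτn hm hmG hθn _ _ _ _ _).trans ?_
    rw [hB, mul_assoc m⁻¹]
    refine mul_le_mul_of_nonneg_left ?_ (inv_nonneg.2 hm.le)
    have h1 : ‖x (n + 1) - (x n + κ n • (x n - x (n - 1)))‖ ≤ (1 + κbar) * (D + D') := by
      rw [← sub_sub]
      refine (norm_sub_le _ _).trans ?_
      rw [norm_smul, Real.norm_of_nonneg (hx.κ_mem n).1]
      have : κ n * D' ≤ κbar * D' := mul_le_mul_of_nonneg_right (hx.κ_mem n).2 hD'0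
      nlinarith [mul_nonneg hκ0 hD0]
    have h2 : 1 / τ n * ‖x (n + 1) - (x n + μ n • (x n - x (n - 1)))‖
        ≤ (1 / t + μbar) * (D + D') := by
      rw [← sub_sub]
      have h3 := norm_sub_le (x (n + 1) - x n) (μ n • (x n - x (n - 1)))
      rw [norm_smul, Real.norm_of_nonneg (hx.μ_mem n).1] at h3
      have h4 : 1 / τ n ≤ 1 / t := one_div_le_one_div_of_le ht (hN n hn).le
      have h5 : 1 / τ n * (μ n * D') ≤ μbar * D' := by
        rw [← mul_assoc, one_div_mul_eq_div]
        exact mul_le_mul_of_nonneg_right ((div_le_iff₀ hτn).2 (hx.μ_mem n).2) hD'0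
      have h6 : 1 / τ n * D ≤ 1 / t * D := mul_le_mul_of_nonneg_right h4 hD0
      have h7 := mul_le_mul_of_nonneg_left h3 (one_div_pos.2 hτn).le
      have h8 : 0 ≤ 1 / t * D' := by positivity
      have h9 := mul_nonneg hμ0 hD0
      linarith
    have h3 : theta f g (x n) * ‖w n - gradient (fun p => (g p).toReal) (x (n + 1))‖
        ≤ K * K * (D + D') := by
      rw [hw, mul_assoc]
      refine mul_le_mul hθK (hww.trans ?_) (norm_nonneg _) hK
      exact mul_le_mul_of_nonneg_left (by linarith) hK
    have h4 : |theta f g (x n) - theta f g (x (n + 1))|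
        * ‖gradient (fun p => (g p).toReal) (x (n + 1))‖ ≤ K * K * (D + D') := by
      have := mul_le_mul hθθ hwK (norm_nonneg _) (by positivity)
      have h5 := mul_nonneg (mul_nonneg hK hK) hD'0
      linarith
    have h5 := mul_le_mul_of_nonneg_left h1 (by positivity : 0 ≤ 2 * ℓ)
    linarith
  refine ⟨⟨q, mem_frechetSubdiff_of_minorant hR1 hR2 hR3, hqB.trans ?_⟩,
    ⟨_, mem_frechetSubdiff_meritFn hR1 hR2 hR3 c (x n),
      (norm_meritFn_subgradient_le _ _ hc).trans ?_⟩⟩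
  · exact mul_le_mul_of_nonneg_right (by linarith) (by positivity)
  · have := mul_nonneg hc hD'0
    linarith

/-- A bounded sequence of feasible points with bounded objective values has a feasible cluster
point. -/
theorem exists_feasible_cluster [ProperSpace H] (hf : NumeratorAssumption S f fs fn ℓ)
    (hg : DenominatorAssumption S g β) (hSc : IsClosed S) (hx : ∀ n, x n ∈ S ∩ dom f)
    (hb : Bornology.IsBounded (range x)) {T : ℝ} (hT : ∀ n, theta f g (x n) ≤ T) :
    ∃ a ∈ S ∩ dom f, ∃ ψ : ℕ → ℕ, StrictMono ψ ∧ Tendsto (x ∘ ψ) atTop (𝓝 a) := by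
  obtain ⟨a, -, ψ, hψ, hlim⟩ := tendsto_subseq_of_bounded hb (fun n => mem_range_self n)
  have haS : a ∈ S := hSc.mem_of_tendsto hlim (Eventually.of_forall fun n => (hx _).1)
  refine ⟨a, ⟨haS, hf.mem_dom_iff.2 ?_⟩, ψ, hψ, hlim⟩
  obtain ⟨M, hM, hMb⟩ := exists_bound_of_isBounded hg hSc hb
    (by rintro _ ⟨n, rfl⟩; exact (hx n).1)
  have hfs : ∀ᶠ n in atTop, fs a - 1 < fs (x (ψ n)) :=
    ((hf.smooth.continuous.tendsto a).comp hlim).eventually (lt_mem_nhds (by linarith))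
  by_contra hcon
  have htop := not_lt_top_iff.1 hcon
  -- If `fn a = ⊤`, lower semicontinuity pushes `fn` past every level. Together with `hfs`, this one
  -- contradicts `f ≤ |T| M` along the sequence.
  have hlarge : ∀ᶠ n in atTop, ((|T| * M - fs a + 1 : ℝ) : EReal) < fn (x (ψ n)) :=
    hlim.eventually (hf.lsc a _ (by change _ < fn a; rw [htop]; exact EReal.coe_lt_top _))
  obtain ⟨n, h1, h2⟩ := (hfs.and hlarge).exists
  have hD := hx (ψ n)
  have hG := hg.toReal_pos hD.1
  rw [← hf.coe_toReal_fn hD.2, EReal.coe_lt_coe_iff] at h2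
  have h3 : (f (x (ψ n))).toReal ≤ |T| * M := by
    have h4 : (f (x (ψ n))).toReal = theta f g (x (ψ n)) * (g (x (ψ n))).toReal := by
      rw [theta_eq f g hf hg hD, div_mul_cancel₀ _ hG.ne']
    rw [h4]
    exact mul_le_mul ((hT _).trans (le_abs_self T)) (hMb _ (mem_range_self _)) hG.le
      (abs_nonneg _)
  rw [hf.toReal_eq hD.2] at h3
  linarith

end Algorithm

/-! ### Finite length and rates from the Kurdyka–Łojasiewicz inequality. -/

section KurdykaLojasiewicz

/-- Any one subgradient bounds the distance to the subdifferential from above, so the KL inequality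
can be used with real numbers only. -/
theorem KLWith.exists_nhds {E : Type*} [NormedAddCommGroup E] [InnerProductSpace ℝ E]
    {h : E → EReal} {a : E} {η : EReal} {φ : ℝ → ℝ} (hK : KLWith h a η φ) {L : ℝ}
    (hL : h a = (L : EReal)) :
    ∃ U ∈ 𝓝 a, ∀ z ∈ U, ∀ v : ℝ, h z = (v : EReal) → L < v → ((v - L : ℝ) : EReal) < η →
      ∀ p ∈ limitingSubdiff h z, 1 ≤ deriv φ (v - L) * ‖p‖ := by
  obtain ⟨-, hη, hφ, U, hU, hKU⟩ := hK
  refine ⟨U, hU, fun z hz v hv hLv hvη p hp => ?_⟩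
  have h1 : h a < h z := by rw [hL, hv]; exact_mod_cast hLv
  have h2 : h z < h a + η := by
    rw [hL, hv]
    have h3 := EReal.add_lt_add_left_coe hvη L
    rwa [← EReal.coe_add, add_sub_cancel] at h3
  have h3 := hKU z hz h1 h2
  rw [hL, hv, ← EReal.coe_sub, EReal.toReal_coe] at h3
  have hpos := hφ.deriv_pos (v - L) (sub_pos.2 hLv) hvη
  have h4 : Metric.infEDist (0 : E) (limitingSubdiff h z) ≤ ENNReal.ofReal ‖p‖ := by
    refine (Metric.infEDist_le_edist_of_mem hp).trans_eq ?_
    rw [edist_dist, dist_zero_left]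
  have h5 : 1 ≤ ENNReal.ofReal (deriv φ (v - L) * ‖p‖) := by
    rw [ENNReal.ofReal_mul hpos.le]
    exact h3.trans (mul_le_mul_right h4 _)
  exact ENNReal.one_le_ofReal.1 h5

variable {H : Type*} [NormedAddCommGroup H] [InnerProductSpace ℝ H]

theorem exists_radius_toLp {X : Type*} [SeminormedAddCommGroup X] {a : X}
    {U : Set (WithLp 2 (X × X))}
    (hU : U ∈ 𝓝 (WithLp.toLp 2 (a, a))) :
    ∃ r > (0 : ℝ), ∀ y z : X, dist y a < r → dist z a < r → WithLp.toLp 2 (y, z) ∈ U := by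
  have hc : Tendsto (fun p : X × X => WithLp.toLp 2 p) (𝓝 (a, a)) (𝓝 (WithLp.toLp 2 (a, a))) :=
    (WithLp.prod_continuous_toLp 2 X X).tendsto _
  obtain ⟨r, hr, hball⟩ := Metric.mem_nhds_iff.1 (hc hU)
  rw [← ball_prod_same] at hball
  exact ⟨r, hr, fun y z hy hz => hball (mk_mem_prod hy hz)⟩

variable {x : ℕ → H} {h : WithLp 2 (H × H) → EReal} {F : ℕ → ℝ} {L α₀ b r : ℝ} {N : ℕ} {a : H}

theorem tendsto_dist_of_sufficient_decrease {X : Type*} [SeminormedAddCommGroup X] {x : ℕ → X}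
    (hα : 0 < α₀)
    (hdec : ∀ n, F (n + 1) + α₀ * ‖x (n + 1) - x n‖ ^ 2 ≤ F n) (hlim : Tendsto F atTop (𝓝 L)) :
    Tendsto (fun n => ‖x (n + 1) - x n‖) atTop (𝓝 0) := by
  have h1 : Tendsto (fun n => (F n - F (n + 1)) / α₀) atTop (𝓝 0) := by
    simpa using (hlim.sub ((tendsto_add_atTop_iff_nat 1).2 hlim)).div_const α₀
  have h2 : Tendsto (fun n => ‖x (n + 1) - x n‖ ^ 2) atTop (𝓝 0) := by
    refine squeeze_zero (fun n => by positivity) (fun n => ?_) h1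
    rw [le_div_iff₀ hα]
    linarith [hdec n]
  simpa using h2.sqrt

/-- Finite length of sequences with sufficient decrease and a relative error condition, for
functions with the Kurdyka–Łojasiewicz property at a cluster point. -/
theorem summable_of_KLAt (hα : 0 < α₀) (hb : 0 < b) (hr : 0 < r)
    (hF : ∀ n, h (WithLp.toLp 2 (x (n + 1), x n)) = (F (n + 1) : EReal))
    (hdec : ∀ n, F (n + 1) + α₀ * ‖x (n + 1) - x n‖ ^ 2 ≤ F n)
    (hlim : Tendsto F atTop (𝓝 L))
    (hsub : ∀ n ≥ N, dist (x n) a < r → dist (x (n + 1)) a < r →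
      ∃ p ∈ limitingSubdiff h (WithLp.toLp 2 (x (n + 1), x n)),
        ‖p‖ ≤ b * (‖x (n + 1) - x n‖ + ‖x n - x (n - 1)‖))
    (hcl : MapClusterPt a atTop x) (ha : h (WithLp.toLp 2 (a, a)) = (L : EReal))
    (hKL : KLAt h (WithLp.toLp 2 (a, a))) :
    Summable (fun n => ‖x (n + 1) - x n‖) := by
  have hanti : Antitone F := antitone_nat_of_succ_le fun n => by
    have : 0 ≤ α₀ * ‖x (n + 1) - x n‖ ^ 2 := by positivity
    linarith [hdec n]
  have hge : ∀ n, L ≤ F n := fun n => hanti.le_of_tendsto hlim n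
  -- Once the limit value is attained the sequence is constant; otherwise `φ'` can be evaluated at
  -- every `F n - L > 0` below `η`.
  by_cases hfin : ∃ n₀, F n₀ = L
  · obtain ⟨n₀, hn₀⟩ := hfin
    rw [← summable_nat_add_iff n₀]
    convert summable_zero with n
    have h1 := hdec (n + n₀)
    have h2 : F (n + n₀) ≤ F n₀ := hanti (by omega)
    have h3 : α₀ * ‖x (n + n₀ + 1) - x (n + n₀)‖ ^ 2 ≤ 0 := by linarith [hge (n + n₀ + 1)]
    have h4 := nonpos_of_mul_nonpos_right h3 hα
    exact pow_eq_zero_iff (two_ne_zero) |>.1 (le_antisymm h4 (by positivity))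
  push Not at hfin
  have hgt : ∀ n, 0 < F n - L := fun n => sub_pos.2 (lt_of_le_of_ne (hge n) (hfin n).symm)
  obtain ⟨η, φ, hK⟩ := hKL
  obtain ⟨U, hU, hKU⟩ := hK.exists_nhds ha
  obtain ⟨-, hη, hφ, -⟩ := hK
  obtain ⟨r', hr', hrU⟩ := exists_radius_toLp hU
  have hlim0 : Tendsto (fun n => F n - L) atTop (𝓝 0) := by simpa using hlim.sub_const L
  have hηev : ∀ᶠ n in atTop, ((F n - L : ℝ) : EReal) < η :=
    ((continuous_coe_real_ereal.tendsto 0).comp hlim0).eventually (gt_mem_nhds hη)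
  obtain ⟨N', hN'⟩ := eventually_atTop.1 hηev
  have hd0 := tendsto_dist_of_sufficient_decrease hα hdec hlim
  have hφ0 : Tendsto (fun n => φ (F n - L)) atTop (𝓝 0) := by
    have h1 := hφ.continuousOn 0 ⟨le_rfl, hη⟩
    rw [ContinuousWithinAt, hφ.map_zero] at h1
    exact h1.comp (tendsto_nhdsWithin_iff.2 ⟨hlim0, hηev.mono fun n hn => ⟨(hgt n).le, hn⟩⟩)
  have hdist : ∀ n, dist (x n) (x (n + 1)) = ‖x (n + 1) - x n‖ := fun n => by
    rw [dist_comm, dist_eq_norm]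
  simp only [← hdist] at hd0 hdec hsub ⊢
  -- The absolute value makes `e` nonnegative for all `n`; `φ` is known to be nonnegative only on
  -- `[0, η)`.
  refine summable_dist_of_step_le (a := a) (r := min r r') (lt_min hr hr')
    (e := fun n => b / α₀ * |φ (F n - L)|) (fun n => by positivity)
    (by simpa using hφ0.abs.const_mul (b / α₀)) hd0 hcl (N := max N N') ?_
  intro n hn h0 h1 h2
  -- The KL inequality at `(x (n+2), x (n+1))` involves the two steps leading to `x (n+2)` and
  -- controls the next one.
  obtain ⟨p, hp, hpb⟩ := hsub (n + 1) (by omega) (h1.trans_le (min_le_left _ _))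
    (h2.trans_le (min_le_left _ _))
  rw [Nat.add_sub_cancel, ← hdist n] at hpb
  have hη2 := hN' (n + 2) (by omega)
  have hη3 := hN' (n + 3) (by omega)
  have hkl := hKU _ (hrU _ _ (h2.trans_le (min_le_right _ _)) (h1.trans_le (min_le_right _ _)))
    _ (hF (n + 1)) (sub_pos.1 (hgt _)) hη2 p hp
  have hpos := hφ.deriv_pos _ (hgt (n + 2)) hη2
  have htan := hφ.deriv_mul_sub_le (hgt (n + 2)) hη2 (hgt (n + 3)).le
    (sub_le_sub_right (hanti (Nat.le_succ (n + 2))) L)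
  have hn2 := hφ.nonneg _ (hgt (n + 2)).le hη2
  have hn3 := hφ.nonneg _ (hgt (n + 3)).le hη3
  have hkl' := hkl.trans (mul_le_mul_of_nonneg_left hpb hpos.le)
  rw [sub_sub_sub_cancel_right] at htan
  have hmain := le_of_sq_le_of_one_le_mul hα hb hpos (by positivity)
    (le_sub_iff_add_le'.2 (hdec (n + 2)))
    htan hkl'
  simp only [abs_of_nonneg hn2, abs_of_nonneg hn3]
  rw [mul_sub] at hmain
  exact hmain

/-- Geometric decay of the function values under the Kurdyka–Łojasiewicz property with exponent
at most `1 / 2`. -/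
theorem exists_geometric_of_KLExponentAt (hα : 0 < α₀) (hb : 0 < b) (hr : 0 < r)
    (hF : ∀ n, h (WithLp.toLp 2 (x (n + 1), x n)) = (F (n + 1) : EReal))
    (hdec : ∀ n, F (n + 1) + α₀ * ‖x (n + 1) - x n‖ ^ 2 ≤ F n)
    (hlim : Tendsto F atTop (𝓝 L))
    (hsub : ∀ n ≥ N, dist (x n) a < r → dist (x (n + 1)) a < r →
      ∃ p ∈ limitingSubdiff h (WithLp.toLp 2 (x (n + 1), x n)),
        ‖p‖ ≤ b * (‖x (n + 1) - x n‖ + ‖x n - x (n - 1)‖))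
    (hx : Tendsto x atTop (𝓝 a)) (ha : h (WithLp.toLp 2 (a, a)) = (L : EReal))
    {α : ℝ} (hα2 : α ≤ 1 / 2) (hKL : KLExponentAt h (WithLp.toLp 2 (a, a)) α) :
    ∃ γ > (0 : ℝ), ∃ ρ ∈ Ioo (0 : ℝ) 1, ∀ n, F n - L ≤ γ * ρ ^ n := by
  have hanti : Antitone F := antitone_nat_of_succ_le fun n => by
    have : 0 ≤ α₀ * ‖x (n + 1) - x n‖ ^ 2 := by positivity
    linarith [hdec n]
  have hge : ∀ n, 0 ≤ F n - L := fun n => sub_nonneg.2 (hanti.le_of_tendsto hlim n)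
  obtain ⟨hα0, hα1, η, γ, hγ, hK⟩ := hKL
  obtain ⟨U, hU, hKU⟩ := hK.exists_nhds ha
  have hη := hK.2.1
  obtain ⟨r', hr', hrU⟩ := exists_radius_toLp hU
  have hlim0 : Tendsto (fun n => F n - L) atTop (𝓝 0) := by simpa using hlim.sub_const L
  have hηev : ∀ᶠ n in atTop, ((F n - L : ℝ) : EReal) < η :=
    ((continuous_coe_real_ereal.tendsto 0).comp hlim0).eventually (gt_mem_nhds hη)
  obtain ⟨N', hN'⟩ := eventually_atTop.1 ((hηev.and (hlim0.eventually (gt_mem_nhds one_pos))).and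
    (hx.eventually (Metric.ball_mem_nhds a (lt_min hr hr'))))
  set A := γ * (1 - α) * b with hA
  have hA0 : 0 < A := mul_pos (mul_pos hγ (by linarith)) hb
  refine exists_le_geometric_of_two_step hge (fun m n hmn => sub_le_sub_right (hanti hmn) L)
    (K := 2 * A ^ 2 / α₀) (by positivity) (N := max N N') ?_
  intro n hn
  have hdiff : F n - L - (F (n + 2) - L) = F n - F (n + 2) := by ring
  -- The KL inequality says nothing at the limit value itself.
  rcases (hge (n + 2)).eq_or_lt with h0 | hpos
  · rw [hdiff, ← h0]
    exact mul_nonneg (by positivity) (sub_nonneg.2 (hanti (by omega)))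
  obtain ⟨-, hx1⟩ := hN' (n + 1) (by omega)
  obtain ⟨⟨hη2, hlt1⟩, hx2⟩ := hN' (n + 2) (by omega)
  obtain ⟨p, hp, hpb⟩ := hsub (n + 1) (by omega) (lt_of_lt_of_le hx1 (min_le_left _ _))
    (lt_of_lt_of_le hx2 (min_le_left _ _))
  rw [Nat.add_sub_cancel] at hpb
  have hkl := hKU _ (hrU _ _ (lt_of_lt_of_le hx2 (min_le_right _ _))
    (lt_of_lt_of_le hx1 (min_le_right _ _))) _ (hF (n + 1)) (sub_pos.1 hpos) hη2 p hp
  set s := F (n + 2) - L with hs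
  have hderiv : deriv (fun s : ℝ => γ * s ^ (1 - α)) s = γ * (1 - α) * s ^ (-α) := by
    have h1 := (Real.hasDerivAt_rpow_const (p := 1 - α) (Or.inl hpos.ne')).const_mul γ
    rw [h1.deriv, sub_sub_cancel_left]
    ring
  change 1 ≤ deriv (fun s : ℝ => γ * s ^ (1 - α)) s * ‖p‖ at hkl
  rw [hderiv] at hkl
  set D := ‖x (n + 1 + 1) - x (n + 1)‖ with hD
  set D' := ‖x (n + 1) - x n‖ with hD'
  have hsα : s ^ α ≤ A * (D + D') := by
    have h1 : s ^ α * (γ * (1 - α) * s ^ (-α) * ‖p‖) = γ * (1 - α) * ‖p‖ := by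
      have : s ^ α * s ^ (-α) = 1 := by rw [← Real.rpow_add hpos]; simp
      linear_combination γ * (1 - α) * ‖p‖ * this
    have h2 : s ^ α * 1 ≤ s ^ α * (γ * (1 - α) * s ^ (-α) * ‖p‖) :=
      mul_le_mul_of_nonneg_left hkl (by positivity)
    have h3 : γ * (1 - α) * ‖p‖ ≤ γ * (1 - α) * (b * (D + D')) :=
      mul_le_mul_of_nonneg_left hpb (mul_nonneg hγ.le (by linarith))
    rw [hA]
    linarith
  -- Here `2α ≤ 1` enters: `s < 1` gives `s ≤ s ^ (2α)`. The squared steps are then paid for by `F n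
  -- - F (n + 2)`.
  have hs2 : s ≤ A ^ 2 * (D + D') ^ 2 := by
    calc s = s ^ (1 : ℝ) := (Real.rpow_one s).symm
      _ ≤ s ^ (α * (2 : ℕ)) := Real.rpow_le_rpow_of_exponent_ge hpos hlt1.le (by
          push_cast; linarith)
      _ = (s ^ α) ^ 2 := Real.rpow_mul_natCast hpos.le α 2
      _ ≤ (A * (D + D')) ^ 2 := pow_le_pow_left₀ (by positivity) hsα 2
      _ = _ := by ring
  have h1 := hdec n
  have h2 := hdec (n + 1)
  have h3 : α₀ * (D + D') ^ 2 ≤ 2 * (F n - F (n + 2)) := by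
    have : α₀ * (D + D') ^ 2 ≤ α₀ * (2 * (D ^ 2 + D' ^ 2)) := by
      refine mul_le_mul_of_nonneg_left ?_ hα.le
      nlinarith [sq_nonneg (D - D')]
    linarith
  rw [hdiff, div_mul_eq_mul_div, le_div_iff₀ hα]
  calc s * α₀ ≤ A ^ 2 * (D + D') ^ 2 * α₀ := mul_le_mul_of_nonneg_right hs2 hα.le
    _ = A ^ 2 * (α₀ * (D + D') ^ 2) := by ring
    _ ≤ A ^ 2 * (2 * (F n - F (n + 2))) := mul_le_mul_of_nonneg_left h3 (by positivity)
    _ = _ := by ring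

end KurdykaLojasiewicz

end EPSG

end

/-! ### The convergence theorem. -/

theorem theorem5p5 {H : Type*} [NormedAddCommGroup H] [InnerProductSpace ℝ H]
    [FiniteDimensional ℝ H] [CompleteSpace H]
    (S : Set H) (hS_ne : S.Nonempty) (hS_closed : IsClosed S) (hS_convex : Convex ℝ S)
    (f : H → EReal) (fs : H → ℝ) (fn g fl : H → EReal) (C : Set H)
    (ℓ β δ ζ μbar κbar c : ℝ) (x w : ℕ → H) (τ κ μ : ℕ → ℝ)
    (hf : EPSG.NumeratorAssumption S f fs fn ℓ)
    (hg : EPSG.DenominatorAssumption S g β)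
    (hfn : EPSG.NonsmoothAssumption S f fn g fl C)
    (hparams : EPSG.AdmissibleParams S f g ℓ β δ ζ μbar κbar c)
    (hx : EPSG.IsIterates S f fs fn g ℓ β δ ζ μbar κbar x w τ κ μ)
    (hτ : 0 < liminf τ atTop)
    (hgC1 : ∃ U : Set H, IsOpen U ∧ S ∩ EPSG.dom f ⊆ U ∧ EPSG.ContDiffFnOn U g)
    (hgLip : ∃ ε > (0 : ℝ), ∃ ℓg > (0 : ℝ), ∀ y ∈ S ∩ EPSG.dom f, ∀ z ∈ S ∩ EPSG.dom f,
      ‖y - z‖ ≤ ε →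
        ‖gradient (fun p => (g p).toReal) y - gradient (fun p => (g p).toReal) z‖
          ≤ ℓg * ‖y - z‖)
    (hbdd : Bornology.IsBounded {y ∈ S | f y / g y ≤ f (x 0) / g (x 0)})
    (hKL : ∀ y ∈ S ∩ EPSG.dom f,
      EPSG.KLAt (EPSG.meritFn S f g c) (WithLp.toLp 2 (y, y))) :
    Summable (fun n => ‖x (n + 1) - x n‖) ∧
    ∃ xinf : H, Tendsto x atTop (𝓝 xinf) ∧ EPSG.IsStationary S f g xinf ∧
      ∀ α : ℝ, α ≤ 1 / 2 →
        (∀ y ∈ S ∩ EPSG.dom f,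
          EPSG.KLExponentAt (EPSG.meritFn S f g c) (WithLp.toLp 2 (y, y)) α) →
        ∃ γ₁ > (0 : ℝ), ∃ γ₂ > (0 : ℝ), ∃ ρ ∈ Ioo (0 : ℝ) 1, ∀ n : ℕ,
          (EPSG.meritFn S f g c (WithLp.toLp 2 (x (n + 1), x n))
            - EPSG.meritFn S f g c (WithLp.toLp 2 (xinf, xinf))).abs
              ≤ ENNReal.ofReal (γ₁ * ρ ^ n) ∧
          ‖x n - xinf‖ ≤ γ₂ * ρ ^ ((n : ℝ) / 2) := by
  obtain ⟨U, hU, hDU, hgU⟩ := hgC1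
  obtain ⟨ε, hε, ℓg, hℓg, hLip⟩ := hgLip
  have hD := hx.feasible hf
  have hℓ := hf.modulus_nonneg
  have hc := (hparams.nonneg hℓ).1
  obtain ⟨α₀, hα₀, hdec⟩ :=
    hx.exists_sufficient_decrease hf hg hparams hS_convex hS_closed hU hDU hgU hbdd
  set F := EPSG.meritSeq f g c x with hFdef
  have hθF : ∀ n, EPSG.theta f g (x n) ≤ F n := fun n =>
    le_add_of_nonneg_right (mul_nonneg hc (sq_nonneg _))
  have hF : ∀ n, EPSG.meritFn S f g c (WithLp.toLp 2 (x (n + 1), x n)) = (F (n + 1) : EReal) :=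
    fun n => EPSG.meritFn_of_mem hf hg (hD (n + 1)) c (x n)
  have hanti : Antitone F := antitone_nat_of_succ_le fun n => by
    have : 0 ≤ α₀ * ‖x (n + 1) - x n‖ ^ 2 := by positivity
    linarith [hdec n]
  have hF0 : F 0 = EPSG.theta f g (x 0) := by simp [hFdef, EPSG.meritSeq]
  have hθ0 : ∀ n, EPSG.theta f g (x n) ≤ EPSG.theta f g (x 0) := fun n =>
    (hθF n).trans ((hanti (Nat.zero_le n)).trans_eq hF0)
  have hFlim : Tendsto F atTop (𝓝 (⨅ n, F n)) :=
    tendsto_atTop_ciInf hanti ⟨0, by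
      rintro _ ⟨n, rfl⟩
      exact (EPSG.theta_nonneg hf hg (hD n)).trans (hθF n)⟩
  have hd0 := EPSG.tendsto_dist_of_sufficient_decrease hα₀ hdec hFlim
  have hd0' : Tendsto (fun n => ‖x n - x (n - 1)‖) atTop (𝓝 0) :=
    (tendsto_add_atTop_iff_nat 1).1 hd0
  have hθlim : Tendsto (fun n => EPSG.theta f g (x n)) atTop (𝓝 (⨅ n, F n)) := by
    have h1 := hFlim.sub ((hd0'.pow 2).const_mul c)
    simpa [hFdef, EPSG.meritSeq] using h1
  have hrange : Bornology.IsBounded (range x) := hbdd.subset (by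
    rintro _ ⟨n, rfl⟩
    exact EPSG.mem_levelSet hf hg (hD n) hx.init (hθ0 n))
  obtain ⟨a, ha, ψ, hψ, hψa⟩ := EPSG.exists_feasible_cluster hf hg hS_closed hD hrange hθ0
  -- Lower semicontinuity would give only `≤`; the Lipschitz bound on the feasible set gives
  -- equality.
  have hθa : EPSG.theta f g a = ⨅ n, F n := by
    obtain ⟨-, -, K, -, r, hr, -, hK⟩ :=
      EPSG.exists_local_bounds hf hg hfn hU hDU hgU hε hℓg hLip ha
    refine tendsto_nhds_unique (tendsto_iff_norm_sub_tendsto_zero.2 ?_)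
      (hθlim.comp hψ.tendsto_atTop)
    have h1 : Tendsto (fun n => K * ‖(x ∘ ψ) n - a‖) atTop (𝓝 0) := by
      simpa using (tendsto_iff_norm_sub_tendsto_zero.1 hψa).const_mul K
    refine squeeze_zero' (Eventually.of_forall fun n => norm_nonneg _) ?_ h1
    filter_upwards [hψa.eventually (Metric.ball_mem_nhds a hr)] with n hn
    exact (hK _ (hD _) _ ha hn (by rwa [dist_self])).1
  have hha : EPSG.meritFn S f g c (WithLp.toLp 2 (a, a)) = ((⨅ n, F n : ℝ) : EReal) := by
    rw [EPSG.meritFn_of_mem hf hg ha, hθa]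
    simp
  obtain ⟨b, hb, r, hr, N, hsub⟩ :=
    hx.exists_subgradient_bound hf hg hfn hparams hτ hU hDU hgU hε hℓg hLip ha
  have hsub' : ∀ n ≥ N, dist (x n) a < r → dist (x (n + 1)) a < r →
      ∃ p ∈ EPSG.limitingSubdiff (EPSG.meritFn S f g c) (WithLp.toLp 2 (x (n + 1), x n)),
        ‖p‖ ≤ b * (‖x (n + 1) - x n‖ + ‖x n - x (n - 1)‖) := fun n hn h1 h2 => by
    obtain ⟨p, hp, hpb⟩ := (hsub n hn h1 h2).2
    exact ⟨p, EPSG.frechetSubdiff_subset_limitingSubdiff _ _ hp, hpb⟩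
  have hsum := EPSG.summable_of_KLAt hα₀ hb hr hF hdec hFlim hsub'
    (MapClusterPt.of_comp hψ.tendsto_atTop hψa.mapClusterPt) hha (hKL a ha)
  have hdist : ∀ n, dist (x n) (x (n + 1)) = ‖x (n + 1) - x n‖ := fun n => by
    rw [dist_comm, dist_eq_norm]
  have hxa : Tendsto x atTop (𝓝 a) :=
    tendsto_nhds_of_cauchySeq_of_subseq
      (cauchySeq_of_summable_dist (by simpa only [hdist] using hsum)) hψ.tendsto_atTop hψa
  refine ⟨hsum, a, hxa, ⟨ha.1, ?_⟩, ?_⟩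
  · have hratio : EPSG.ratioFn S f g a = (EPSG.theta f g a : EReal) :=
      EPSG.ratioFn_of_mem hf hg ha
    obtain ⟨N', hN'⟩ := eventually_atTop.1 (hxa.eventually (Metric.ball_mem_nhds a hr))
    -- The shift by `N + N'` makes the local subgradient bound valid for every index, as the
    -- definition of the limiting subdifferential requires.
    have hq : ∀ n, ∃ q ∈ EPSG.frechetSubdiff (EPSG.ratioFn S f g) (x (n + (N + N') + 1)),
        ‖q‖ ≤ b * (‖x (n + (N + N') + 1) - x (n + (N + N'))‖
          + ‖x (n + (N + N')) - x (n + (N + N') - 1)‖) := fun n =>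
      (hsub (n + (N + N')) (by omega) (hN' _ (by omega)) (hN' _ (by omega))).1
    choose q hq hqb using hq
    have hshift : Tendsto (fun n => n + (N + N')) atTop atTop := tendsto_add_atTop_nat _
    have hshift' : Tendsto (fun n => n + (N + N') + 1) atTop atTop :=
      (tendsto_add_atTop_nat 1).comp hshift
    refine ⟨by simp [EPSG.FiniteAt, hratio], fun n => x (n + (N + N') + 1), q,
      hxa.comp hshift', ?_, ?_, hq⟩
    · simp only [EPSG.ratioFn_of_mem hf hg (hD _), hratio, hθa]
      exact (continuous_coe_real_ereal.tendsto _).comp (hθlim.comp hshift')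
    · refine squeeze_zero_norm hqb ?_
      simpa using ((hd0.comp hshift).add (hd0'.comp hshift)).const_mul b
  · intro α hα hKLα
    obtain ⟨γ, hγ, ρ, hρ, hrate⟩ := EPSG.exists_geometric_of_KLExponentAt hα₀ hb hr hF hdec hFlim
      hsub' hxa hha hα (hKLα a ha)
    have hge : ∀ n, (⨅ n, F n) ≤ F n := fun n => hanti.le_of_tendsto hFlim n
    -- The decrease gives `α₀‖x (n+1) - x n‖² ≤ F n - F (n+1) ≤ γ ρ ^ n`; the square root halves the
    -- exponent.
    obtain ⟨γ', hγ', hrate'⟩ := EPSG.exists_dist_le_geometric_of_sq_le hxa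
      (div_pos hγ hα₀) hρ (fun n => by
        rw [hdist, div_mul_eq_mul_div, le_div_iff₀ hα₀]
        linarith [hdec n, hrate n, hge (n + 1)])
    refine ⟨γ, hγ, γ', hγ', ρ, hρ, fun n => ⟨?_, by simpa only [dist_eq_norm] using hrate' n⟩⟩
    rw [hF, hha, ← EReal.coe_sub, EReal.abs_def]
    refine ENNReal.ofReal_le_ofReal ?_
    rw [abs_of_nonneg (sub_nonneg.2 (hge _))]
    linarith [hanti (Nat.le_succ n), hrate n]
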